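/- Let $G$ be a locally compact Hausdorff étale groupoid and let $G^{(0)}\times\mathbb T\hookrightarrow\Sigma\overset{q}{\twoheadrightarrow}G$ be a twist over $G$, i.e. a locally trivial central extension of topological groupoids with $\Sigma$ locally compact and Hausdorff. Let $C_c(\Sigma;G)$ be the $*$-algebra of continuous compactly supported sections of the associated line bundle over $G$ (equivalently, of functions $f\in C_c(\Sigma)$ with $f(\lambda\cdot\sigma)=\overline\lambda f(\sigma)$ for $\lambda\in\mathbb T$), and let $C_r^*(\Sigma;G)$ be the norm closure of the image of $C_c(\Sigma;G)$ under the left regular representation $\lambda(f)\xi=f*\xi$ on the Hilbert space of square-summable sections of the line bundle over the discrete set $G$. Let $H$ be an open subgroupoid of $G$ (not assumed to contain $G^{(0)}$), let $\Sigma_H=q^{-1}(H)$, and let $\Sigma_H\to H$ be the restricted twist. Then extension by zero $C_c(\Sigma_H;H)\to C_c(\Sigma;G)$ induces an isometric $*$-homomorphism $\iota\colon C_r^*(\Sigma_H;H)\to C_r^*(\Sigma;G)$. Identify $C_r^*(\Sigma_H;H)$ with its image under $\iota$. Then there is a conditional expectation $F$ from $C_r^*(\Sigma;G)$ onto $C_r^*(\Sigma_H;H)$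 (a contractive, positive, linear, $C_r^*(\Sigma_H;H)$-bimodule map that restricts to the identity on $C_r^*(\Sigma_H;H)$) if and only if $H$ is closed in $G$. -/

import Mathlib

open scoped ENNReal

/-! ## Topological groupoids -/

/-- A topological groupoid, presented on its set `G` of arrows; units are identified with the
corresponding identity arrows.  The product `mul a b` is meaningful only if `src a = rng b`; its
values elsewhere carry no information and nothing below depends on them. -/
class TopGroupoid (G : Type*) [TopologicalSpace G] where
  src : G → G
  rng : G → G
  inv : G → G
  mul : G → G → G
  src_src : ∀ a, src (src a) = src a
  rng_src : ∀ a, rng (src a) = src a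
  src_rng : ∀ a, src (rng a) = rng a
  rng_rng : ∀ a, rng (rng a) = rng a
  src_mul : ∀ a b, src a = rng b → src (mul a b) = src b
  rng_mul : ∀ a b, src a = rng b → rng (mul a b) = rng a
  mul_assoc : ∀ a b c, src a = rng b → src b = rng c → mul (mul a b) c = mul a (mul b c)
  rng_mul_self : ∀ a, mul (rng a) a = a
  mul_src_self : ∀ a, mul a (src a) = a
  src_inv : ∀ a, src (inv a) = rng a
  rng_inv : ∀ a, rng (inv a) = src a
  mul_inv_self : ∀ a, mul a (inv a) = rng a
  inv_mul : ∀ a, mul (inv a) a = src a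
  continuous_arrowInv : Continuous inv
  continuousOn_arrowMul : ContinuousOn (fun p : G × G => mul p.1 p.2) {p | src p.1 = rng p.2}

namespace TopGroupoid

variable {G : Type*} [TopologicalSpace G] [TopGroupoid G]

/-- The unit space `G⁰`. -/
def unitSpace (G : Type*) [TopologicalSpace G] [TopGroupoid G] : Set G := {x | rng x = x}

/-- The range of an arrow, as a point of the unit space. -/
def rngUnit (a : G) : unitSpace G := ⟨rng a, rng_rng a⟩

/-- The source of an arrow, as a point of the unit space. -/
def srcUnit (a : G) : unitSpace G := ⟨src a, rng_src a⟩

theorem continuous_rng : Continuous (rng : G → G) := by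
  have h : (rng : G → G) = (fun p : G × G => mul p.1 p.2) ∘ fun a => (a, inv a) := by
    funext a; simp [mul_inv_self]
  rw [h]
  exact continuousOn_arrowMul.comp_continuous (continuous_id.prodMk continuous_arrowInv)
    fun a => (rng_inv a).symm

theorem inv_inv (a : G) : inv (inv a) = a := by
  have h1 : mul (inv (inv a)) (mul (inv a) a) = mul (mul (inv (inv a)) (inv a)) a :=
    (mul_assoc _ _ _ (by rw [src_inv]) (by rw [src_inv])).symm
  rw [inv_mul, inv_mul, src_inv, rng_mul_self, ← rng_inv (a := a), ← src_inv, mul_src_self] at h1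
  exact h1

theorem inv_inj_of_eq {a b : G} (h : inv a = inv b) : a = b := by
  rw [← inv_inv a, h, inv_inv]

theorem mul_inv_cancel_right {a b : G} (h : src a = src b) : mul (mul a (inv b)) b = a := by
  rw [mul_assoc a (inv b) b (by rw [rng_inv, h]) (by rw [src_inv]), inv_mul, ← h, mul_src_self]

theorem inv_mul_cancel_left {a b : G} (h : src a = rng b) : mul (inv a) (mul a b) = b := by
  rw [← mul_assoc (inv a) a b (by rw [src_inv]) h, inv_mul, h, rng_mul_self]

end TopGroupoid

open TopGroupoid

/-- A topological groupoid is étale if its range map is a local homeomorphism. -/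
class IsEtale (G : Type*) [TopologicalSpace G] [TopGroupoid G] : Prop where
  isLocalHomeomorph_rng : IsLocalHomeomorph (rng : G → G)

/-- An open subgroupoid: an open set of arrows closed under composition and inversion.  It is
not required to contain all units of `G`. -/
structure OpenSubgroupoid (G : Type*) [TopologicalSpace G] [TopGroupoid G] where
  carrier : Set G
  isOpen : IsOpen carrier
  mul_mem : ∀ a ∈ carrier, ∀ b ∈ carrier, src a = rng b → mul a b ∈ carrier
  inv_mem : ∀ a ∈ carrier, inv a ∈ carrier

namespace OpenSubgroupoid

variable {G : Type*} [TopologicalSpace G] [TopGroupoid G] (H : OpenSubgroupoid G)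

theorem src_mem {a : G} (ha : a ∈ H.carrier) : src a ∈ H.carrier := by
  rw [← inv_mul]
  exact H.mul_mem _ (H.inv_mem _ ha) _ ha (src_inv a)

theorem rng_mem {a : G} (ha : a ∈ H.carrier) : rng a ∈ H.carrier := by
  rw [← mul_inv_self]
  exact H.mul_mem _ ha _ (H.inv_mem _ ha) (rng_inv a).symm

open Classical in
/-- Composition in an open subgroupoid: that of `G` on composable pairs, and junk elsewhere. -/
noncomputable def comp (a b : H.carrier) : H.carrier :=
  if h : src a.1 = rng b.1 then ⟨mul a.1 b.1, H.mul_mem _ a.2 _ b.2 h⟩ else a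

theorem coe_comp (a b : H.carrier) (h : src a.1 = rng b.1) : (H.comp a b).1 = mul a.1 b.1 := by
  rw [comp, dif_pos h]

/-- An open subgroupoid as a topological groupoid, with the relative topology. -/
noncomputable instance : TopGroupoid H.carrier where
  src a := ⟨src a.1, H.src_mem a.2⟩
  rng a := ⟨rng a.1, H.rng_mem a.2⟩
  inv a := ⟨inv a.1, H.inv_mem _ a.2⟩
  mul a b := H.comp a b
  src_src a := Subtype.ext (src_src _)
  rng_src a := Subtype.ext (rng_src _)
  src_rng a := Subtype.ext (src_rng _)
  rng_rng a := Subtype.ext (rng_rng _)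
  src_mul a b h := by
    have h' : src a.1 = rng b.1 := congrArg Subtype.val h
    apply Subtype.ext
    simp only [coe_comp _ _ _ h']
    exact src_mul _ _ h'
  rng_mul a b h := by
    have h' : src a.1 = rng b.1 := congrArg Subtype.val h
    apply Subtype.ext
    simp only [coe_comp _ _ _ h']
    exact rng_mul _ _ h'
  mul_assoc a b c hab hbc := by
    have h1 : src a.1 = rng b.1 := congrArg Subtype.val hab
    have h2 : src b.1 = rng c.1 := congrArg Subtype.val hbc
    apply Subtype.ext
    rw [coe_comp _ (H.comp a b) c (by rw [coe_comp _ _ _ h1, src_mul _ _ h1, h2]),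
      coe_comp _ a (H.comp b c) (by rw [coe_comp _ _ _ h2, rng_mul _ _ h2, h1]),
      coe_comp _ _ _ h1, coe_comp _ _ _ h2]
    exact mul_assoc _ _ _ h1 h2
  rng_mul_self a := Subtype.ext ((H.coe_comp _ _ (src_rng _)).trans (rng_mul_self _))
  mul_src_self a := Subtype.ext ((H.coe_comp _ _ (rng_src _).symm).trans (mul_src_self _))
  src_inv a := Subtype.ext (src_inv _)
  rng_inv a := Subtype.ext (rng_inv _)
  mul_inv_self a := Subtype.ext ((H.coe_comp _ _ (rng_inv _).symm).trans (mul_inv_self _))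
  inv_mul a := Subtype.ext ((H.coe_comp _ _ (src_inv _)).trans (inv_mul _))
  continuous_arrowInv := (continuous_arrowInv.comp continuous_subtype_val).subtype_mk _
  continuousOn_arrowMul := by
    rw [Topology.IsInducing.subtypeVal.continuousOn_iff]
    have h : ContinuousOn (fun p : H.carrier × H.carrier => mul p.1.1 p.2.1)
        {p | src p.1.1 = rng p.2.1} :=
      continuousOn_arrowMul.comp (t := {p : G × G | src p.1 = rng p.2})
        (f := fun p : H.carrier × H.carrier => (p.1.1, p.2.1))
        (by fun_prop) (fun p hp => hp)
    exact (h.congr fun p hp => H.coe_comp _ _ hp).mono fun p hp => congrArg Subtype.val hp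

theorem coe_src (a : H.carrier) : (src a : H.carrier).1 = src a.1 := rfl
theorem coe_rng (a : H.carrier) : (rng a : H.carrier).1 = rng a.1 := rfl
theorem coe_inv (a : H.carrier) : (inv a : H.carrier).1 = inv a.1 := rfl
theorem coe_mul (a b : H.carrier) (h : src a.1 = rng b.1) :
    (mul a b : H.carrier).1 = mul a.1 b.1 := H.coe_comp a b h

instance [IsEtale G] : IsEtale H.carrier where
  isLocalHomeomorph_rng := by
    have hv : IsLocalHomeomorph (Subtype.val : H.carrier → G) :=
      H.isOpen.isOpenEmbedding_subtypeVal.isLocalHomeomorph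
    have h : IsLocalHomeomorph ((Subtype.val : H.carrier → G) ∘ (rng : H.carrier → H.carrier)) :=
      IsEtale.isLocalHomeomorph_rng.comp hv
    exact IsLocalHomeomorph.of_comp h hv
      ((continuous_rng.comp continuous_subtype_val).subtype_mk _)

/-- The inclusion of unit spaces `H⁰ ⊆ G⁰`. -/
def unitIncl (x : unitSpace H.carrier) : unitSpace G := ⟨x.1.1, congrArg Subtype.val x.2⟩

end OpenSubgroupoid

/-! ## Twists -/

/-- A twist `G⁰ × 𝕋 ↪ Σ ↠ G` over `G` (with `S` for `Σ`): a central extension of groupoids,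
with continuous homomorphisms `incl`, `proj`, which is locally trivial. -/
structure Twist (S G : Type*) [TopologicalSpace S] [TopGroupoid S]
    [TopologicalSpace G] [TopGroupoid G] where
  proj : S → G
  incl : unitSpace G × Circle → S
  continuous_proj : Continuous proj
  proj_surjective : Function.Surjective proj
  proj_src : ∀ σ, proj (src σ) = src (proj σ)
  proj_rng : ∀ σ, proj (rng σ) = rng (proj σ)
  proj_mul : ∀ σ τ, src σ = rng τ → proj (mul σ τ) = mul (proj σ) (proj τ)
  continuous_incl : Continuous incl
  incl_injective : Function.Injective incl
  src_incl : ∀ x z, src (incl (x, z)) = incl (x, 1)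
  rng_incl : ∀ x z, rng (incl (x, z)) = incl (x, 1)
  incl_mul : ∀ x z w, mul (incl (x, z)) (incl (x, w)) = incl (x, z * w)
  proj_incl : ∀ x z, proj (incl (x, z)) = x
  /-- Exactness: the preimage of the unit space is the image of `incl`. -/
  exact : ∀ σ, proj σ ∈ unitSpace G → σ ∈ Set.range incl
  central : ∀ σ z, mul (incl (rngUnit (proj σ), z)) σ = mul σ (incl (srcUnit (proj σ), z))
  /-- Every `γ` has an open neighbourhood `U` with a continuous section `u : U → Σ` such that
  `(x, z) ↦ z · u x` is a homeomorphism of `U × 𝕋` onto the (open) set `proj ⁻¹ U`. -/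
  locally_trivial : ∀ γ, ∃ U : Set G, IsOpen U ∧ γ ∈ U ∧ ∃ u : U → S, Continuous u ∧
    (∀ x, proj (u x) = x) ∧
    Topology.IsOpenEmbedding
      (fun p : U × Circle => mul (incl (rngUnit (proj (u p.1)), p.2)) (u p.1))

namespace Twist

variable {S G : Type*} [TopologicalSpace S] [TopGroupoid S] [TopologicalSpace G] [TopGroupoid G]
  (T : Twist S G)

/-- The action `z · σ` of the circle on `Σ`. -/
def act (z : Circle) (σ : S) : S := mul (T.incl (rngUnit (T.proj σ), z)) σ

theorem src_incl_rng (σ : S) (z : Circle) : src (T.incl (rngUnit (T.proj σ), z)) = rng σ := by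
  obtain ⟨⟨x, w⟩, h⟩ := T.exact (rng σ) (by
    change rng _ = _
    rw [T.proj_rng, rng_rng])
  have hx : x = rngUnit (T.proj σ) := by
    apply Subtype.ext
    rw [← T.proj_incl x w, h, T.proj_rng]
    rfl
  rw [T.src_incl, ← hx, ← T.rng_incl x w, h, rng_rng]

theorem rng_incl_src (σ : S) (z : Circle) : rng (T.incl (srcUnit (T.proj σ), z)) = src σ := by
  obtain ⟨⟨x, w⟩, h⟩ := T.exact (src σ) (by
    change rng _ = _
    rw [T.proj_src, rng_src])
  have hx : x = srcUnit (T.proj σ) := by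
    apply Subtype.ext
    rw [← T.proj_incl x w, h, T.proj_src]
    rfl
  rw [T.rng_incl, ← hx, ← T.src_incl x w, h, src_src]

theorem proj_act (z : Circle) (σ : S) : T.proj (T.act z σ) = T.proj σ := by
  rw [act, T.proj_mul _ _ (T.src_incl_rng σ z), T.proj_incl]
  exact rng_mul_self _

theorem src_eq_of_proj {σ τ : S} (h : src (T.proj σ) = src (T.proj τ)) : src σ = src τ := by
  rw [← T.rng_incl_src σ 1, ← T.rng_incl_src τ 1]
  have : srcUnit (T.proj σ) = srcUnit (T.proj τ) := Subtype.ext h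
  rw [this]

theorem proj_inv (σ : S) : T.proj (inv σ) = inv (T.proj σ) := by
  have h := T.proj_mul σ (inv σ) (rng_inv σ).symm
  rw [mul_inv_self, T.proj_rng] at h
  have hs : src (T.proj σ) = rng (T.proj (inv σ)) := by
    rw [← T.proj_rng, rng_inv, T.proj_src]
  have h2 := inv_mul_cancel_left hs
  rw [← h, ← src_inv, mul_src_self] at h2
  exact h2.symm

/-- The open subgroupoid `Σ_H = q⁻¹(H)` of `Σ`. -/
def preimage (H : OpenSubgroupoid G) : OpenSubgroupoid S where
  carrier := T.proj ⁻¹' H.carrier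
  isOpen := H.isOpen.preimage T.continuous_proj
  mul_mem a ha b hb h := by
    rw [Set.mem_preimage, T.proj_mul _ _ h]
    exact H.mul_mem _ ha _ hb (by rw [← T.proj_src, h, T.proj_rng])
  inv_mem a ha := by
    rw [Set.mem_preimage, T.proj_inv]
    exact H.inv_mem _ ha

theorem mem_preimage {H : OpenSubgroupoid G} {σ : S} :
    σ ∈ (T.preimage H).carrier ↔ T.proj σ ∈ H.carrier := Iff.rfl

/-- The restricted twist `H⁰ × 𝕋 ↪ Σ_H ↠ H`. -/
def restrict (H : OpenSubgroupoid G) : Twist (T.preimage H).carrier H.carrier where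
  proj σ := ⟨T.proj σ.1, σ.2⟩
  incl p := ⟨T.incl (H.unitIncl p.1, p.2), by
    rw [mem_preimage, T.proj_incl]
    exact p.1.1.2⟩
  continuous_proj := (T.continuous_proj.comp continuous_subtype_val).subtype_mk _
  proj_surjective γ := by
    obtain ⟨σ, h⟩ := T.proj_surjective γ.1
    exact ⟨⟨σ, by rw [mem_preimage, h]; exact γ.2⟩, Subtype.ext h⟩
  proj_src σ := Subtype.ext (T.proj_src _)
  proj_rng σ := Subtype.ext (T.proj_rng _)
  proj_mul σ τ h := by
    have h1 : src σ.1 = rng τ.1 := congrArg Subtype.val h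
    have h2 : src (T.proj σ.1) = rng (T.proj τ.1) := by
      rw [← T.proj_src, h1, T.proj_rng]
    apply Subtype.ext
    refine Eq.trans ?_ (OpenSubgroupoid.coe_mul _ _ _ h2).symm
    exact (congrArg T.proj (OpenSubgroupoid.coe_mul _ _ _ h1)).trans (T.proj_mul _ _ h1)
  continuous_incl := by
    refine (T.continuous_incl.comp (Continuous.prodMk ?_ continuous_snd)).subtype_mk _
    exact ((continuous_subtype_val.comp
      (continuous_subtype_val.comp continuous_fst)).subtype_mk _)
  incl_injective p p' h := by
    have h1 := T.incl_injective (congrArg Subtype.val h)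
    have h2 : p.1.1.1 = p'.1.1.1 := congrArg (fun t => t.1.1) h1
    exact Prod.ext (Subtype.ext (Subtype.ext h2)) (congrArg (fun t => t.2) h1)
  src_incl x z := Subtype.ext (T.src_incl _ _)
  rng_incl x z := Subtype.ext (T.rng_incl _ _)
  incl_mul x z w := by
    apply Subtype.ext
    rw [OpenSubgroupoid.coe_mul _ _ _ (by rw [T.src_incl, T.rng_incl])]
    exact T.incl_mul _ _ _
  proj_incl x z := Subtype.ext (T.proj_incl _ _)
  exact σ h := by
    obtain ⟨⟨x, z⟩, hx⟩ := T.exact σ.1 (congrArg Subtype.val h)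
    have hx' : (x : G) = T.proj σ.1 := by rw [← T.proj_incl x z, hx]
    refine ⟨(⟨⟨T.proj σ.1, σ.2⟩, h⟩, z), Subtype.ext ?_⟩
    refine Eq.trans ?_ hx
    have h3 : H.unitIncl ⟨⟨T.proj σ.1, σ.2⟩, h⟩ = x := Subtype.ext hx'.symm
    exact congrArg (fun y => T.incl (y, z)) h3
  central σ z := by
    apply Subtype.ext
    rw [OpenSubgroupoid.coe_mul _ _ _ (T.src_incl_rng σ.1 z),
      OpenSubgroupoid.coe_mul _ _ _ (T.rng_incl_src σ.1 z).symm]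
    exact T.central σ.1 z
  locally_trivial γ := by
    obtain ⟨U, hU, hγ, u, hu, hpu, hemb⟩ := T.locally_trivial γ.1
    have hmem : ∀ x : (Subtype.val ⁻¹' U : Set H.carrier),
        u ⟨x.1.1, x.2⟩ ∈ (T.preimage H).carrier := by
      intro x
      rw [mem_preimage, hpu]
      exact x.1.2
    refine ⟨Subtype.val ⁻¹' U, hU.preimage continuous_subtype_val, hγ,
      fun x => ⟨u ⟨x.1.1, x.2⟩, hmem x⟩, ?_, ?_, ?_⟩
    · exact (hu.comp ((continuous_subtype_val.comp
        continuous_subtype_val).subtype_mk _)).subtype_mk _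
    · intro x
      exact Subtype.ext (hpu _)
    · rw [← Topology.IsOpenEmbedding.of_comp_iff _
        (T.preimage H).isOpen.isOpenEmbedding_subtypeVal]
      have hj : Topology.IsOpenEmbedding
          (fun x : (Subtype.val ⁻¹' U : Set H.carrier) => (⟨x.1.1, x.2⟩ : U)) := by
        rw [← Topology.IsOpenEmbedding.of_comp_iff _ hU.isOpenEmbedding_subtypeVal]
        exact H.isOpen.isOpenEmbedding_subtypeVal.comp
          (hU.preimage continuous_subtype_val).isOpenEmbedding_subtypeVal
      have := hemb.comp (hj.prodMap Topology.IsOpenEmbedding.id)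
      convert this using 1
      funext p
      simp only [Function.comp]
      rw [OpenSubgroupoid.coe_mul _ _ _ (T.src_incl_rng (u ⟨p.1.1.1, p.1.2⟩) p.2)]
      rfl

end Twist

/-! ## The reduced C*-algebra of a twist -/

section Schur

variable {ι : Type*} {K : ι → ι → ℂ} {C : ℝ}

theorem schur_summable (hr : ∀ i, ∀ s : Finset ι, ∑ j ∈ s, ‖K i j‖ ≤ C)
    (ξ : lp (fun _ : ι => ℂ) 2) (i : ι) : Summable fun j => ‖K i j * ξ j‖ := by
  have h1 : Summable fun j => ‖K i j‖ := summable_of_sum_le (fun _ => norm_nonneg _) (hr i)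
  refine Summable.of_nonneg_of_le (fun _ => norm_nonneg _) (fun j => ?_) (h1.mul_right ‖ξ‖)
  rw [norm_mul]
  gcongr
  exact lp.norm_apply_le_norm (by norm_num) ξ j

/-- The Schur test: a kernel with uniformly bounded absolute row and column sums is bounded. -/
theorem schur_bound (hC : 0 ≤ C) (hr : ∀ i, ∀ s : Finset ι, ∑ j ∈ s, ‖K i j‖ ≤ C)
    (hc : ∀ j, ∀ s : Finset ι, ∑ i ∈ s, ‖K i j‖ ≤ C)
    (ξ : lp (fun _ : ι => ℂ) 2) (s : Finset ι) :
    ∑ i ∈ s, ‖∑' j, K i j * ξ j‖ ^ (2 : ℝ≥0∞).toReal ≤ (C * ‖ξ‖) ^ (2 : ℝ≥0∞).toReal := by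
  have hξ (t : Finset ι) : ∑ j ∈ t, ‖ξ j‖ ^ 2 ≤ ‖ξ‖ ^ 2 := by
    simpa using lp.sum_rpow_le_norm_rpow (p := 2) (by norm_num) ξ t
  have hs2 : Summable fun j => ‖ξ j‖ ^ 2 := summable_of_sum_le (fun _ => by positivity) hξ
  have hKle (i j : ι) : ‖K i j‖ ≤ C := by simpa using hr i {j}
  have hsum (i : ι) : Summable fun j => ‖K i j‖ * ‖ξ j‖ ^ 2 :=
    Summable.of_nonneg_of_le (fun _ => by positivity)
      (fun j => mul_le_mul_of_nonneg_right (hKle i j) (by positivity)) (hs2.mul_left C)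
  have hrow (i : ι) : ‖∑' j, K i j * ξ j‖ ^ 2 ≤ C * ∑' j, ‖K i j‖ * ‖ξ j‖ ^ 2 := by
    have h0 : 0 ≤ C * ∑' j, ‖K i j‖ * ‖ξ j‖ ^ 2 :=
      mul_nonneg hC (tsum_nonneg fun _ => by positivity)
    have h1 : ‖∑' j, K i j * ξ j‖ ≤ √(C * ∑' j, ‖K i j‖ * ‖ξ j‖ ^ 2) := by
      refine (norm_tsum_le_tsum_norm (schur_summable hr ξ i)).trans
        ((schur_summable hr ξ i).tsum_le_of_sum_le fun t => ?_)
      apply Real.le_sqrt_of_sq_le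
      calc (∑ j ∈ t, ‖K i j * ξ j‖) ^ 2
          ≤ (∑ j ∈ t, ‖K i j‖) * ∑ j ∈ t, ‖K i j‖ * ‖ξ j‖ ^ 2 :=
            Finset.sum_sq_le_sum_mul_sum_of_sq_le_mul t (fun _ _ => norm_nonneg _)
              (fun _ _ => by positivity) (fun j _ => le_of_eq (by rw [norm_mul]; ring))
        _ ≤ C * ∑' j, ‖K i j‖ * ‖ξ j‖ ^ 2 := by
            gcongr
            · exact hr i t
            · exact (hsum i).sum_le_tsum t fun _ _ => by positivity
    calc ‖∑' j, K i j * ξ j‖ ^ 2 ≤ √(C * ∑' j, ‖K i j‖ * ‖ξ j‖ ^ 2) ^ 2 := by gcongr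
      _ = _ := Real.sq_sqrt h0
  have hmain : ∑ i ∈ s, ‖∑' j, K i j * ξ j‖ ^ 2 ≤ (C * ‖ξ‖) ^ 2 :=
    calc ∑ i ∈ s, ‖∑' j, K i j * ξ j‖ ^ 2
        ≤ ∑ i ∈ s, C * ∑' j, ‖K i j‖ * ‖ξ j‖ ^ 2 := Finset.sum_le_sum fun i _ => hrow i
      _ = C * ∑' j, ∑ i ∈ s, ‖K i j‖ * ‖ξ j‖ ^ 2 := by
          rw [← Finset.mul_sum, Summable.tsum_finsetSum fun i _ => hsum i]
      _ ≤ C * (C * ‖ξ‖ ^ 2) := by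
          gcongr
          refine (summable_sum fun i _ => hsum i).tsum_le_of_sum_le fun t => ?_
          calc ∑ j ∈ t, ∑ i ∈ s, ‖K i j‖ * ‖ξ j‖ ^ 2 ≤ ∑ j ∈ t, C * ‖ξ j‖ ^ 2 := by
                refine Finset.sum_le_sum fun j _ => ?_
                rw [← Finset.sum_mul]
                gcongr
                exact hc j s
            _ ≤ C * ‖ξ‖ ^ 2 := by
                rw [← Finset.mul_sum]
                gcongr
                exact hξ t
      _ = (C * ‖ξ‖) ^ 2 := by ring
  simpa using hmain

/-- The operator on `ℓ²` with a given kernel satisfying the hypotheses of the Schur test. -/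
theorem schur_exists (hC : 0 ≤ C) (hr : ∀ i, ∀ s : Finset ι, ∑ j ∈ s, ‖K i j‖ ≤ C)
    (hc : ∀ j, ∀ s : Finset ι, ∑ i ∈ s, ‖K i j‖ ≤ C) :
    ∃ A : lp (fun _ : ι => ℂ) 2 →L[ℂ] lp (fun _ : ι => ℂ) 2,
      ∀ ξ i, A ξ i = ∑' j, K i j * ξ j := by
  let L : lp (fun _ : ι => ℂ) 2 →ₗ[ℂ] lp (fun _ : ι => ℂ) 2 :=
    { toFun := fun ξ => ⟨fun i => ∑' j, K i j * ξ j, memℓp_gen' (schur_bound hC hr hc ξ)⟩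
      map_add' := fun ξ η => by
        ext i
        change ∑' j, K i j * (ξ j + η j) = ∑' j, K i j * ξ j + ∑' j, K i j * η j
        rw [← (schur_summable hr ξ i).of_norm.tsum_add (schur_summable hr η i).of_norm]
        simp only [mul_add]
      map_smul' := fun c ξ => by
        ext i
        change ∑' j, K i j * (c * ξ j) = c * ∑' j, K i j * ξ j
        rw [← tsum_mul_left]
        congr 1
        funext j
        ring }
  refine ⟨L.mkContinuous C fun ξ => ?_, fun ξ i => rfl⟩
  exact lp.norm_le_of_forall_sum_le (p := 2) (by norm_num) (by positivity)
    (schur_bound hC hr hc ξ)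

end Schur

/-- In an étale groupoid, each compact set is covered by finitely many bisections. -/
theorem IsEtale.exists_card_le {G : Type*} [TopologicalSpace G] [TopGroupoid G] [IsEtale G]
    {K : Set G} (hK : IsCompact K) : ∃ N : ℕ, ∀ F : Finset G, (∀ a ∈ F, a ∈ K) →
      ((∀ a ∈ F, ∀ b ∈ F, rng a = rng b) ∨ (∀ a ∈ F, ∀ b ∈ F, src a = src b)) →
      F.card ≤ N := by
  classical
  have hloc : ∀ a : G, ∃ U : Set G, IsOpen U ∧ a ∈ U ∧ Set.InjOn rng U := by
    intro a
    obtain ⟨e, he, h⟩ := IsEtale.isLocalHomeomorph_rng (G := G) a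
    exact ⟨e.source, e.open_source, he, by rw [h]; exact e.injOn⟩
  have hbis : ∀ a : G, ∃ U : Set G, IsOpen U ∧ a ∈ U ∧ Set.InjOn rng U ∧ Set.InjOn src U := by
    intro a
    obtain ⟨U, hU, haU, hUr⟩ := hloc a
    obtain ⟨V, hV, haV, hVr⟩ := hloc (inv a)
    refine ⟨U ∩ inv ⁻¹' V, hU.inter (hV.preimage continuous_arrowInv), ⟨haU, haV⟩,
      hUr.mono Set.inter_subset_left, ?_⟩
    intro b hb c hc hbc
    exact inv_inj_of_eq (hVr hb.2 hc.2 (by rw [rng_inv, rng_inv, hbc]))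
  choose U hU haU hUr hUs using hbis
  obtain ⟨t, ht⟩ := hK.elim_finite_subcover U hU (fun a _ => Set.mem_iUnion.2 ⟨a, haU a⟩)
  refine ⟨t.card, fun F hF h => ?_⟩
  have hcov : ∀ a ∈ F, ∃ i ∈ t, a ∈ U i := by
    intro a ha
    simpa using ht (hF a ha)
  choose! g hg hgU using hcov
  refine Finset.card_le_card_of_injOn g (fun a ha => hg a ha) ?_
  intro a ha b hb hab
  have h1 := hgU a ha
  have h2 := hgU b hb
  rw [← hab] at h2
  rcases h with h | h
  · exact hUr _ h1 h2 (h a ha b hb)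
  · exact hUs _ h1 h2 (h a ha b hb)

namespace Twist

variable {S G : Type*} [TopologicalSpace S] [TopGroupoid S] [TopologicalSpace G] [TopGroupoid G]
  (T : Twist S G)

/-- `C_c(Σ; G)`: the continuous compactly supported sections of the line bundle `L = (ℂ × Σ) / 𝕋`
over `G`, `[z λ, σ] = [z, λ · σ]`.  The section with values `[f σ, σ]` is recorded as the function
`f : Σ → ℂ`, which has to satisfy `f (λ · σ) = conj λ * f σ`. -/
structure Cc where
  toFun : S → ℂ
  continuous_toFun : Continuous toFun
  hasCompactSupport : HasCompactSupport toFun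
  map_act : ∀ z σ, toFun (T.act z σ) = (starRingEnd ℂ) (z : ℂ) * toFun σ

variable {T}

open Classical in
/-- The kernel of left convolution by `f`.  Sections of `L` over the discrete set `G` are
identified with functions `ξ : G → ℂ` through a (discontinuous) section `c` of `q`, so that
`(f * ξ)(γ) = ∑ f(c γ (c β)⁻¹) ξ(β)` over the `β` with the same source as `γ`. Another choice of
`c` conjugates the operators by a diagonal unitary. -/
noncomputable def Cc.kernel (f : T.Cc) (γ β : G) : ℂ :=
  if src γ = src β then
    f.toFun (mul (Function.surjInv T.proj_surjective γ)
      (inv (Function.surjInv T.proj_surjective β)))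
  else 0

theorem Cc.kernel_ne_zero {f : T.Cc} {γ β : G} (h : f.kernel γ β ≠ 0) :
    src γ = src β ∧ mul γ (inv β) ∈ T.proj '' tsupport f.toFun := by
  unfold Cc.kernel at h
  split_ifs at h with hs
  · refine ⟨hs, _, subset_tsupport _ h, ?_⟩
    have hγ := Function.surjInv_eq T.proj_surjective γ
    have hβ := Function.surjInv_eq T.proj_surjective β
    rw [T.proj_mul, T.proj_inv, hγ, hβ]
    rw [rng_inv]
    exact T.src_eq_of_proj (by rw [hγ, hβ, hs])
  · exact absurd rfl h

theorem Cc.exists_kernel_bound [IsEtale G] (f : T.Cc) : ∃ C : ℝ, 0 ≤ C ∧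
    (∀ γ, ∀ s : Finset G, ∑ β ∈ s, ‖f.kernel γ β‖ ≤ C) ∧
    (∀ β, ∀ s : Finset G, ∑ γ ∈ s, ‖f.kernel γ β‖ ≤ C) := by
  classical
  obtain ⟨N, hN⟩ := IsEtale.exists_card_le (f.hasCompactSupport.isCompact.image T.continuous_proj)
  obtain ⟨M, hM⟩ := f.continuous_toFun.bounded_above_of_compact_support f.hasCompactSupport
  have hk (γ β : G) : ‖f.kernel γ β‖ ≤ max M 0 := by
    unfold Cc.kernel
    split_ifs
    · exact (hM _).trans (le_max_left _ _)
    · simp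
  have key (k : G → ℂ) (s : Finset G) (hk : ∀ a, ‖k a‖ ≤ max M 0)
      (hcard : (s.filter fun a => k a ≠ 0).card ≤ N) : ∑ a ∈ s, ‖k a‖ ≤ N * max M 0 := by
    rw [← Finset.sum_filter_of_ne (p := fun a => k a ≠ 0)
      (fun a _ h => by simpa using h)]
    refine (Finset.sum_le_card_nsmul _ _ _ fun a _ => hk a).trans ?_
    rw [nsmul_eq_mul]
    gcongr
  refine ⟨N * max M 0, by positivity, fun γ s => ?_, fun β s => ?_⟩
  · refine key _ s (hk γ) ?_
    rw [← Finset.card_image_of_injOn (f := fun β => mul γ (inv β))]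
    · refine hN _ ?_ (Or.inl ?_)
      · simp only [Finset.mem_image, Finset.mem_filter]
        rintro _ ⟨β, ⟨_, hβ⟩, rfl⟩
        exact (Cc.kernel_ne_zero hβ).2
      · simp only [Finset.mem_image, Finset.mem_filter]
        rintro _ ⟨β, ⟨_, hβ⟩, rfl⟩ _ ⟨β', ⟨_, hβ'⟩, rfl⟩
        rw [rng_mul _ _ (by rw [rng_inv, (Cc.kernel_ne_zero hβ).1]),
          rng_mul _ _ (by rw [rng_inv, (Cc.kernel_ne_zero hβ').1])]
    · intro β hβ β' hβ' h
      simp only [Finset.coe_filter, Set.mem_ofPred_eq] at hβ hβ' h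
      apply inv_inj_of_eq
      have h1 : src γ = rng (inv β) := by rw [rng_inv, (Cc.kernel_ne_zero hβ.2).1]
      have h2 : src γ = rng (inv β') := by rw [rng_inv, (Cc.kernel_ne_zero hβ'.2).1]
      rw [← inv_mul_cancel_left h1, h, inv_mul_cancel_left h2]
  · refine key (fun γ => f.kernel γ β) s (fun γ => hk γ β) ?_
    rw [← Finset.card_image_of_injOn (f := fun γ => mul γ (inv β))]
    · refine hN _ ?_ (Or.inr ?_)
      · simp only [Finset.mem_image, Finset.mem_filter]
        rintro _ ⟨γ, ⟨_, hγ⟩, rfl⟩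
        exact (Cc.kernel_ne_zero hγ).2
      · simp only [Finset.mem_image, Finset.mem_filter]
        rintro _ ⟨γ, ⟨_, hγ⟩, rfl⟩ _ ⟨γ', ⟨_, hγ'⟩, rfl⟩
        rw [src_mul _ _ (by rw [rng_inv, (Cc.kernel_ne_zero hγ).1]),
          src_mul _ _ (by rw [rng_inv, (Cc.kernel_ne_zero hγ').1])]
    · intro γ hγ γ' hγ' h
      simp only [Finset.coe_filter, Set.mem_ofPred_eq] at hγ hγ' h
      rw [← mul_inv_cancel_right (Cc.kernel_ne_zero hγ.2).1, h,
        mul_inv_cancel_right (Cc.kernel_ne_zero hγ'.2).1]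

/-- Extension by zero `C_c(Σ_H; H) → C_c(Σ; G)`. -/
noncomputable def Cc.extend [T2Space S] {H : OpenSubgroupoid G} (f : (T.restrict H).Cc) :
    T.Cc where
  toFun := Function.extend Subtype.val f.toFun 0
  continuous_toFun := f.hasCompactSupport.continuous_extend_zero (T.preimage H).isOpen
    f.continuous_toFun
  hasCompactSupport := f.hasCompactSupport.extend_zero continuous_subtype_val
  map_act z σ := by
    by_cases h : σ ∈ (T.preimage H).carrier
    · have h1 : (Subtype.val ((T.restrict H).act z ⟨σ, h⟩) : S) = T.act z σ :=
        OpenSubgroupoid.coe_mul _ _ _ (T.src_incl_rng σ z)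
      rw [← h1, Subtype.val_injective.extend_apply, f.map_act]
      congr 1
      exact (Subtype.val_injective.extend_apply f.toFun 0 ⟨σ, h⟩).symm
    · have h2 : T.act z σ ∉ (T.preimage H).carrier := by
        rwa [mem_preimage, T.proj_act]
      rw [Function.extend_apply' _ _ _ (fun ⟨a, ha⟩ => h2 (ha ▸ a.2)),
        Function.extend_apply' _ _ _ (fun ⟨a, ha⟩ => h (ha ▸ a.2))]
      simp

variable [IsEtale G]

theorem Cc.exists_regularRep (f : T.Cc) :
    ∃ A : lp (fun _ : G => ℂ) 2 →L[ℂ] lp (fun _ : G => ℂ) 2,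
      ∀ ξ γ, A ξ γ = ∑' β, f.kernel γ β * ξ β := by
  obtain ⟨C, hC, hr, hc⟩ := f.exists_kernel_bound
  exact schur_exists hC hr hc

/-- The left regular representation `λ(f) ξ = f * ξ` of `C_c(Σ; G)`, the direct sum over `x ∈ G⁰`
of the representations on the Hilbert spaces `ℓ²(G_x; L)`. -/
noncomputable def Cc.regularRep (f : T.Cc) :
    lp (fun _ : G => ℂ) 2 →L[ℂ] lp (fun _ : G => ℂ) 2 :=
  f.exists_regularRep.choose

theorem Cc.regularRep_apply (f : T.Cc) (ξ : lp (fun _ : G => ℂ) 2) (γ : G) :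
    f.regularRep ξ γ = ∑' β, f.kernel γ β * ξ β :=
  f.exists_regularRep.choose_spec ξ γ

variable (T) in
/-- The reduced C*-algebra `C*_r(Σ; G)`: the C*-algebra of operators generated by the image of
the left regular representation (which is a *-algebra, so this is its norm closure). -/
noncomputable def reducedCStar :
    NonUnitalStarSubalgebra ℂ (lp (fun _ : G => ℂ) 2 →L[ℂ] lp (fun _ : G => ℂ) 2) :=
  (NonUnitalStarAlgebra.adjoin ℂ
    (Set.range fun f : T.Cc => f.regularRep)).topologicalClosure

noncomputable instance : NonUnitalCStarAlgebra T.reducedCStar :=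
  NonUnitalStarSubalgebra.nonUnitalCStarAlgebra _
    (h_closed := NonUnitalStarSubalgebra.isClosed_topologicalClosure _)

/-- The canonical map `C_c(Σ; G) → C*_r(Σ; G)`. -/
noncomputable def Cc.toReduced (f : T.Cc) : T.reducedCStar :=
  ⟨f.regularRep, NonUnitalStarSubalgebra.le_topologicalClosure _
    (NonUnitalStarAlgebra.subset_adjoin ℂ _ ⟨f, rfl⟩)⟩

end Twist

/-! ## Conditional expectations -/

/-- A conditional expectation of a C*-algebra `A` onto a C*-subalgebra `B`: a contractive positive
linear projection of `A` onto `B` which is `B`-bilinear.  (Complete positivity follows, since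
`∑ bᵢ* F(aᵢ* aⱼ) bⱼ = F(c* c)` for `c = ∑ aᵢ bᵢ`.) -/
structure IsConditionalExpectation {A : Type*} [NonUnitalCStarAlgebra A]
    (B : NonUnitalStarSubalgebra ℂ A) (F : A →ₗ[ℂ] A) : Prop where
  mem : ∀ a, F a ∈ B
  apply_of_mem : ∀ b ∈ B, F b = b
  norm_le : ∀ a, ‖F a‖ ≤ ‖a‖
  nonneg : ∀ a, ∃ c, F (star a * a) = star c * c
  map_mul_left : ∀ b ∈ B, ∀ a, F (b * a) = b * F a
  map_mul_right : ∀ b ∈ B, ∀ a, F (a * b) = F a * b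

/-!
The *-algebra `C_c(Σ; G)` acts on `ℓ²(G)` by kernel operators.  Convolution by a section supported
on an open set on which the range map is injective has a one-term formula, and a partition of unity
reduces the general case to it; so the image of `C_c(Σ; G)` is a *-algebra and `C*_r(Σ; G)` is its
closure.  Reading off matrix entries extends the inverse of the left regular representation to a
map `Twist.symbol` from `C*_r(Σ; G)` to continuous sections of the line bundle, and an element is
determined by its columns at units (`Twist.eq_zero_of_unit_columns`).

Let `V : ℓ²(H) → ℓ²(G)` be the inclusion (`Twist.incl₂`; up to phases, since the kernels depend on
choices of lifts to `Σ`), and let `E a = V* a V` be compression to `ℓ²(H)`.  Extensions by zero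
leave `ℓ²(H)` and its complement invariant and annihilate the basis vectors at units outside `H`.
On the C*-algebra of all `b` in `C*_r(Σ; G)` with these properties and with `E b` in
`C*_r(Σ_H; H)`, the map `E` is a *-homomorphism onto a dense part of `C*_r(Σ_H; H)`.  It is
injective, because `b` is determined by its columns at units; so it is isometric and onto, and `ι`
is its inverse (`Twist.exists_embedding`).  No decomposition of `ℓ²(G)` into orbits of `H` is
needed.

If `H` is closed, hence clopen, `E` restricts sections to `H` and so maps `C*_r(Σ; G)` into
`C*_r(Σ_H; H)`; then `ι ∘ E` is the conditional expectation.

Conversely, let `F` be a conditional expectation and suppose `γ` lies in the closure of `H` but not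
in `H`.  Choose a section `f` supported on an open bisection `U` around `γ` with `f γ ≠ 0`.  For
`h ∈ H ∩ U` and `g` supported in `H ∩ U` with `g h ≠ 0`, the product `g* f` is supported on units
of `H`, whence `g* F(f) = F(g* f) = g* f` and the symbol of `F(f)` agrees with `f` at `h`
(`Twist.symbol_expectation_eq`).  The symbol of `F(f)` is continuous and vanishes off `H`, so that
`f γ = 0` in the limit, a contradiction.
-/

/-! ### Arrows of groupoids and twists -/

namespace TopGroupoid

variable {G : Type*} [TopologicalSpace G] [TopGroupoid G]

theorem continuous_src : Continuous (src : G → G) := by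
  have h : (src : G → G) = rng ∘ inv := funext fun a => (rng_inv a).symm
  rw [h]
  exact continuous_rng.comp continuous_arrowInv

theorem mul_inv_cancel_left {a b : G} (h : rng a = rng b) : mul a (mul (inv a) b) = b := by
  have h1 := inv_mul_cancel_left (a := inv a) (b := b) (by rw [src_inv, h])
  rwa [inv_inv] at h1

theorem mul_left_cancel {a b c : G} (hb : src a = rng b) (hc : src a = rng c)
    (h : mul a b = mul a c) : b = c := by
  rw [← inv_mul_cancel_left hb, h, inv_mul_cancel_left hc]

theorem inv_mul_rev {a b : G} (h : src a = rng b) : inv (mul a b) = mul (inv b) (inv a) := by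
  have h1 : src (inv b) = rng (inv a) := by rw [src_inv, rng_inv, h]
  refine mul_left_cancel (a := mul a b) (by rw [rng_inv]) ?_ ?_
  · rw [rng_mul _ _ h1, rng_inv, src_mul _ _ h]
  · rw [mul_inv_self, rng_mul _ _ h, TopGroupoid.mul_assoc a b _ h (by
      rw [rng_mul _ _ h1, rng_inv]), mul_inv_cancel_left (by rw [rng_inv, h]), mul_inv_self]

theorem inv_eq_self_of_rng_eq {x : G} (hx : rng x = x) : inv x = x := by
  have hs : src x = x := by rw [← hx, src_rng]
  have h := mul_inv_self x
  rw [hx] at h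
  have h2 := rng_mul_self (inv x)
  rw [rng_inv, hs] at h2
  rw [← h2, h]

theorem mul_inv_src (a : G) : mul a (inv (src a)) = a := by
  rw [inv_eq_self_of_rng_eq (rng_src a), mul_src_self]

/-- The set of products `σ τ` of composable arrows `σ ∈ K`, `τ ∈ L`. -/
def mulSet (K L : Set G) : Set G :=
  (fun p : G × G => mul p.1 p.2) '' ({p | src p.1 = rng p.2} ∩ K ×ˢ L)

theorem isCompact_mulSet [T2Space G] {K L : Set G} (hK : IsCompact K) (hL : IsCompact L) :
    IsCompact (mulSet K L) := by
  refine IsCompact.image_of_continuousOn ((hK.prod hL).inter_left ?_)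
    (continuousOn_arrowMul.mono Set.inter_subset_left)
  exact isClosed_eq (continuous_src.comp continuous_fst) (continuous_rng.comp continuous_snd)

/-- Inversion as a homeomorphism. -/
def invHomeomorph (G : Type*) [TopologicalSpace G] [TopGroupoid G] : G ≃ₜ G where
  toFun := inv
  invFun := inv
  left_inv := inv_inv
  right_inv := inv_inv
  continuous_toFun := continuous_arrowInv
  continuous_invFun := continuous_arrowInv

end TopGroupoid

namespace OpenSubgroupoid

variable {G : Type*} [TopologicalSpace G] [TopGroupoid G] (H : OpenSubgroupoid G)

theorem mem_of_mul_inv_mem {a b : G} (h : src a = src b) (hb : b ∈ H.carrier)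
    (hab : mul a (inv b) ∈ H.carrier) : a ∈ H.carrier := by
  rw [← mul_inv_cancel_right h]
  exact H.mul_mem _ hab _ hb (by rw [src_mul _ _ (by rw [rng_inv, h]), src_inv])

end OpenSubgroupoid

namespace Twist

variable {S G : Type*} [TopologicalSpace S] [TopGroupoid S] [TopologicalSpace G] [TopGroupoid G]
  (T : Twist S G)

theorem rng_eq_of_proj {σ τ : S} (h : rng (T.proj σ) = rng (T.proj τ)) : rng σ = rng τ := by
  rw [← T.src_incl_rng σ 1, ← T.src_incl_rng τ 1]
  have : rngUnit (T.proj σ) = rngUnit (T.proj τ) := Subtype.ext h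
  rw [this]

theorem rng_act (z : Circle) (σ : S) : rng (T.act z σ) = rng σ :=
  T.rng_eq_of_proj (by rw [T.proj_act])

theorem src_act (z : Circle) (σ : S) : src (T.act z σ) = src σ :=
  T.src_eq_of_proj (by rw [T.proj_act])

theorem one_act (σ : S) : T.act 1 σ = σ := by
  rw [act, ← T.src_incl _ 1, T.src_incl_rng, rng_mul_self]

theorem act_act (z w : Circle) (σ : S) : T.act z (T.act w σ) = T.act (z * w) σ := by
  unfold act
  rw [← T.incl_mul, TopGroupoid.mul_assoc _ _ _ (by rw [T.src_incl, T.rng_incl])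
    (T.src_incl_rng σ w)]
  change mul (T.incl (rngUnit (T.proj (T.act w σ)), z)) _ = _
  rw [T.proj_act]

theorem act_mul (z : Circle) {σ τ : S} (h : src σ = rng τ) :
    mul (T.act z σ) τ = T.act z (mul σ τ) := by
  unfold act
  rw [TopGroupoid.mul_assoc _ _ _ (T.src_incl_rng σ z) h]
  congr 3
  apply Subtype.ext
  change rng _ = rng _
  rw [← T.proj_rng, ← T.proj_rng, rng_mul _ _ h]

theorem mul_act (z : Circle) {σ τ : S} (h : src σ = rng τ) :
    mul σ (T.act z τ) = T.act z (mul σ τ) := by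
  rw [← T.act_mul z h]
  unfold act
  rw [T.central σ z, TopGroupoid.mul_assoc _ _ _ (T.rng_incl_src σ z).symm]
  · congr 4
    apply Subtype.ext
    change rng _ = src _
    rw [← T.proj_src, ← T.proj_rng, h]
  · rw [T.src_incl, ← T.rng_incl _ z, T.rng_incl_src, h]

theorem inv_act (z : Circle) (σ : S) : inv (T.act z σ) = T.act z⁻¹ (inv σ) := by
  refine mul_left_cancel (a := T.act z σ) (by rw [rng_inv]) (by
    rw [T.rng_act, T.src_act, rng_inv]) ?_
  rw [mul_inv_self, T.mul_act _ (by rw [T.src_act, rng_inv]), T.act_mul _ (rng_inv σ).symm,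
    T.act_act, inv_mul_cancel, T.one_act, mul_inv_self, T.rng_act]

/-- The circle acts transitively on the fibres of `Σ → G`. -/
theorem exists_eq_act {σ τ : S} (h : T.proj τ = T.proj σ) : ∃ z, τ = T.act z σ := by
  have hs : src τ = src σ := T.src_eq_of_proj (by rw [h])
  have hc : src τ = rng (inv σ) := by rw [rng_inv, hs]
  obtain ⟨⟨x, z⟩, hx⟩ := T.exact (mul τ (inv σ)) (by
    change rng _ = _
    rw [T.proj_mul _ _ hc, T.proj_inv, h, mul_inv_self, rng_rng])
  refine ⟨z, ?_⟩
  have hx' : x = rngUnit (T.proj σ) := by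
    apply Subtype.ext
    rw [← T.proj_incl x z, hx, T.proj_mul _ _ hc, T.proj_inv, h, mul_inv_self]
    rfl
  rw [act, ← hx', hx, mul_inv_cancel_right hs]

theorem continuous_act : Continuous fun p : Circle × S => T.act p.1 p.2 := by
  refine continuousOn_arrowMul.comp_continuous (f := fun p : Circle × S =>
    (T.incl (rngUnit (T.proj p.2), p.1), p.2)) ?_ fun p => T.src_incl_rng p.2 p.1
  refine (T.continuous_incl.comp (Continuous.prodMk (Continuous.subtype_mk ?_ _)
    continuous_fst)).prodMk continuous_snd
  exact continuous_rng.comp (T.continuous_proj.comp continuous_snd)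

/-- The map `Σ → G` has local continuous sections; here they are total functions, of interest
only on `U`. -/
theorem exists_continuousOn_section (γ : G) :
    ∃ U : Set G, IsOpen U ∧ γ ∈ U ∧ ∃ u : G → S, ContinuousOn u U ∧ ∀ x ∈ U, T.proj (u x) = x := by
  classical
  obtain ⟨U, hU, hγ, u, hu, hpu, -⟩ := T.locally_trivial γ
  refine ⟨U, hU, hγ, fun x => if h : x ∈ U then u ⟨x, h⟩ else u ⟨γ, hγ⟩, ?_, ?_⟩
  · rw [continuousOn_iff_continuous_domRestrict]
    convert hu using 1
    funext x
    simp
  · intro x hx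
    simp [hx, hpu]

/-- Near the range of `η`, points are ranges of arrows of `Σ` over a given neighbourhood of `η`,
in a continuous way. -/
theorem exists_continuousOn_rng_section [IsEtale G] {W : Set G} (hW : IsOpen W) {η : G}
    (hη : η ∈ W) :
    ∃ V : Set G, IsOpen V ∧ rng η ∈ V ∧ ∃ t : G → S, ContinuousOn t V ∧
      ∀ x ∈ V, T.proj (t x) ∈ W ∧ rng (T.proj (t x)) = x := by
  obtain ⟨e, he, hrng⟩ := IsEtale.isLocalHomeomorph_rng (G := G) η
  obtain ⟨U, hU, hηU, u, hu, hpu⟩ := T.exists_continuousOn_section η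
  have hlift : e.symm (rng η) = η := by rw [hrng, e.left_inv he]
  refine ⟨e.target ∩ e.symm ⁻¹' (W ∩ U),
    e.symm.isOpen_inter_preimage (hW.inter hU), ⟨?_, ?_⟩, fun x => u (e.symm x), ?_, ?_⟩
  · rw [hrng]
    exact e.map_source he
  · rw [Set.mem_preimage, hlift]
    exact ⟨hη, hηU⟩
  · exact hu.comp (e.continuousOn_symm.mono Set.inter_subset_left) fun x hx => hx.2.2
  · intro x hx
    rw [hpu _ hx.2.2]
    exact ⟨hx.2.1, by rw [hrng, e.right_inv hx.1]⟩

/-- The preimage in `Σ` of a compact set is compact if a trivialization is defined on it. -/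
theorem isCompact_preimage_of_subset {K : Set G} (hK : IsCompact K) {U : Set G}
    {u : G → S} (hu : ContinuousOn u U) (hpu : ∀ x ∈ U, T.proj (u x) = x) (hKU : K ⊆ U) :
    IsCompact (T.proj ⁻¹' K) := by
  have h : T.proj ⁻¹' K = (fun p : Circle × G => T.act p.1 (u p.2)) '' (Set.univ ×ˢ K) := by
    ext σ
    constructor
    · intro hσ
      obtain ⟨z, hz⟩ := T.exists_eq_act (hpu _ (hKU hσ)).symm
      exact ⟨(z, T.proj σ), ⟨trivial, hσ⟩, hz.symm⟩
    · rintro ⟨⟨z, x⟩, ⟨-, hx⟩, rfl⟩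
      rw [Set.mem_preimage, T.proj_act, hpu _ (hKU hx)]
      exact hx
  rw [h]
  refine (isCompact_univ.prod hK).image_of_continuousOn ?_
  refine T.continuous_act.comp_continuousOn (continuousOn_fst.prodMk
    (hu.comp continuousOn_snd fun p hp => hKU hp.2))

end Twist

/-- An arrow of an étale groupoid has an open neighbourhood on which the range map is injective. -/
theorem IsEtale.exists_injOn_rng {G : Type*} [TopologicalSpace G] [TopGroupoid G] [IsEtale G]
    (γ : G) : ∃ U : Set G, IsOpen U ∧ γ ∈ U ∧ Set.InjOn rng U := by
  obtain ⟨e, he, h⟩ := IsEtale.isLocalHomeomorph_rng (G := G) γ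
  exact ⟨e.source, e.open_source, he, by rw [h]; exact e.injOn⟩

/-! ### Matrix entries and sections -/

/-- The Hilbert space `ℓ²(ι)`. -/
local notation "ℓ²(" ι ")" => lp (fun _ : ι => ℂ) 2

section MatrixEntries

variable {ι κ : Type*}

open Classical in
/-- The standard basis vector of `ℓ²(ι)` at `i`. The matrix entries of an operator `a` are the
numbers `a (stdVec j) i`. -/
noncomputable def stdVec (i : ι) : ℓ²(ι) := lp.single 2 i 1

theorem stdVec_self (i : ι) : stdVec i i = 1 := by
  classical
  exact lp.single_apply_self _ _ _

theorem stdVec_ne {i j : ι} (h : j ≠ i) : stdVec i j = 0 := by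
  classical
  exact lp.single_apply_ne _ _ _ h

theorem norm_stdVec (i : ι) : ‖stdVec i‖ = 1 := by
  classical
  rw [stdVec, lp.norm_single (by norm_num), norm_one]

theorem inner_stdVec_left (i : ι) (ξ : ℓ²(ι)) : inner ℂ (stdVec i) ξ = ξ i := by
  classical
  rw [stdVec, lp.inner_single_left]
  simp

theorem inner_stdVec_right (i : ι) (ξ : ℓ²(ι)) :
    inner ℂ ξ (stdVec i) = (starRingEnd ℂ) (ξ i) := by
  rw [← inner_conj_symm, inner_stdVec_left]

theorem norm_entry_le (a : ℓ²(ι) →L[ℂ] ℓ²(κ)) (i : ι) (k : κ) : ‖a (stdVec i) k‖ ≤ ‖a‖ := by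
  refine (lp.norm_apply_le_norm (by norm_num) _ k).trans ((a.le_opNorm _).trans ?_)
  rw [norm_stdVec, mul_one]

/-- A bounded operator on `ℓ²` is determined by its values on the standard basis vectors. -/
theorem clm_ext_stdVec {E : Type*} [NormedAddCommGroup E] [NormedSpace ℂ E]
    {a b : ℓ²(ι) →L[ℂ] E} (h : ∀ i, a (stdVec i) = b (stdVec i)) : a = b := by
  classical
  ext1 ξ
  have h1 := lp.hasSum_single (p := 2) (by norm_num) ξ
  have h2 : ∀ i, lp.single 2 i (ξ i) = ξ i • stdVec i := fun i => by
    rw [stdVec, ← lp.single_smul]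
    simp
  simp only [h2] at h1
  have h3 := h1.mapL a
  have h4 := h1.mapL b
  simp only [map_smul, h] at h3 h4
  exact h3.unique h4

theorem clm_ext_entry {a b : ℓ²(ι) →L[ℂ] ℓ²(κ)} (h : ∀ i k, a (stdVec i) k = b (stdVec i) k) :
    a = b :=
  clm_ext_stdVec fun i => by
    ext k
    exact h i k

theorem adjoint_entry (a : ℓ²(ι) →L[ℂ] ℓ²(κ)) (i : ι) (k : κ) :
    a.adjoint (stdVec k) i = (starRingEnd ℂ) (a (stdVec i) k) := by
  rw [← inner_stdVec_left, ContinuousLinearMap.adjoint_inner_right, inner_stdVec_right]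

theorem continuous_entry (i : ι) (k : κ) :
    Continuous fun a : ℓ²(ι) →L[ℂ] ℓ²(κ) => a (stdVec i) k := by
  simp only [← inner_stdVec_left]
  fun_prop

end MatrixEntries

namespace Twist

variable {S G : Type*} [TopologicalSpace S] [TopGroupoid S] [TopologicalSpace G] [TopGroupoid G]
  {T : Twist S G}

variable (T) in
/-- A set-theoretic section of `Σ → G`: the one in terms of which the kernels of convolution
operators are defined. -/
noncomputable def lift (γ : G) : S := Function.surjInv T.proj_surjective γ

theorem proj_lift (γ : G) : T.proj (T.lift γ) = γ := Function.surjInv_eq T.proj_surjective γ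

theorem src_lift_eq {γ β : G} (h : src γ = src β) : src (T.lift γ) = src (T.lift β) :=
  T.src_eq_of_proj (by rw [proj_lift, proj_lift, h])

theorem src_lift_eq_rng_inv {γ β : G} (h : src γ = src β) :
    src (T.lift γ) = rng (inv (T.lift β)) := by
  rw [rng_inv, src_lift_eq h]

theorem proj_lift_mul_inv {γ β : G} (h : src γ = src β) :
    T.proj (mul (T.lift γ) (inv (T.lift β))) = mul γ (inv β) := by
  rw [T.proj_mul _ _ (src_lift_eq_rng_inv h), T.proj_inv, proj_lift, proj_lift]

theorem conj_mul_conj_inv (z : Circle) :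
    (starRingEnd ℂ) (z : ℂ) * (starRingEnd ℂ) ((z⁻¹ : Circle) : ℂ) = 1 := by
  rw [← map_mul, ← Circle.coe_mul, mul_inv_cancel, Circle.coe_one, map_one]

theorem conj_inv_mul_conj (z : Circle) :
    (starRingEnd ℂ) ((z⁻¹ : Circle) : ℂ) * (starRingEnd ℂ) (z : ℂ) = 1 := by
  rw [_root_.mul_comm, conj_mul_conj_inv]

namespace Cc

theorem kernel_of_eq (f : T.Cc) {γ β : G} (h : src γ = src β) :
    f.kernel γ β = f.toFun (mul (T.lift γ) (inv (T.lift β))) := if_pos h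

theorem kernel_of_ne (f : T.Cc) {γ β : G} (h : src γ ≠ src β) : f.kernel γ β = 0 := if_neg h

/-- The zero section. -/
def zero (T : Twist S G) : T.Cc where
  toFun := 0
  continuous_toFun := continuous_zero
  hasCompactSupport := HasCompactSupport.zero
  map_act z σ := by simp

/-- The sum of two sections. -/
def add (f g : T.Cc) : T.Cc where
  toFun := f.toFun + g.toFun
  continuous_toFun := f.continuous_toFun.add g.continuous_toFun
  hasCompactSupport := f.hasCompactSupport.add g.hasCompactSupport
  map_act z σ := by simp only [Pi.add_apply, f.map_act, g.map_act, mul_add]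

/-- The product of a section of the line bundle with a continuous function on `G`. -/
def mulFun (ψ : G → ℂ) (hψ : Continuous ψ) (f : T.Cc) : T.Cc where
  toFun := fun σ => ψ (T.proj σ) * f.toFun σ
  continuous_toFun := (hψ.comp T.continuous_proj).mul f.continuous_toFun
  hasCompactSupport := f.hasCompactSupport.mul_left
  map_act z σ := by
    simp only [T.proj_act, f.map_act]
    ring

theorem proj_mem_of_mem_tsupport_mulFun {ψ : G → ℂ} {hψ : Continuous ψ} {f : T.Cc} {σ : S}
    (h : σ ∈ tsupport (f.mulFun ψ hψ).toFun) : T.proj σ ∈ tsupport ψ :=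
  tsupport_comp_subset_preimage ψ T.continuous_proj (tsupport_mul_subset_left h)

/-- The adjoint section `f* σ = conj (f σ⁻¹)`. -/
def conjInv (f : T.Cc) : T.Cc where
  toFun := fun σ => (starRingEnd ℂ) (f.toFun (inv σ))
  continuous_toFun := Complex.continuous_conj.comp
    (f.continuous_toFun.comp continuous_arrowInv)
  hasCompactSupport :=
    (f.hasCompactSupport.comp_homeomorph (invHomeomorph S)).comp_left (map_zero _)
  map_act z σ := by
    rw [T.inv_act, f.map_act, map_mul]
    rw [Circle.coe_inv_eq_conj, Complex.conj_conj]

variable [IsEtale G]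

theorem regularRep_entry (f : T.Cc) (β γ : G) : f.regularRep (stdVec β) γ = f.kernel γ β := by
  rw [f.regularRep_apply, tsum_eq_single β, stdVec_self, mul_one]
  intro δ hδ
  rw [stdVec_ne hδ, mul_zero]

theorem regularRep_zero : (zero T).regularRep = 0 := by
  refine clm_ext_entry fun β γ => ?_
  rw [regularRep_entry]
  unfold kernel
  split_ifs <;> rfl

theorem regularRep_add (f g : T.Cc) : (f.add g).regularRep = f.regularRep + g.regularRep := by
  refine clm_ext_entry fun β γ => ?_
  change _ = f.regularRep (stdVec β) γ + g.regularRep (stdVec β) γ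
  simp only [regularRep_entry]
  unfold kernel
  split_ifs
  · rfl
  · simp

theorem regularRep_smul (c : ℂ) (f : T.Cc) :
    (f.mulFun (fun _ => c) continuous_const).regularRep = c • f.regularRep := by
  refine clm_ext_entry fun β γ => ?_
  change _ = c * f.regularRep (stdVec β) γ
  simp only [regularRep_entry]
  unfold kernel
  split_ifs
  · rfl
  · simp

theorem regularRep_conjInv (f : T.Cc) : f.conjInv.regularRep = star f.regularRep := by
  refine clm_ext_entry fun β γ => ?_
  rw [ContinuousLinearMap.star_eq_adjoint, adjoint_entry, regularRep_entry, regularRep_entry]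
  by_cases h : src γ = src β
  · rw [kernel_of_eq _ h, kernel_of_eq _ h.symm]
    change (starRingEnd ℂ) (f.toFun _) = _
    rw [inv_mul_rev (src_lift_eq_rng_inv h), TopGroupoid.inv_inv]
  · rw [kernel_of_ne _ h, kernel_of_ne _ (Ne.symm h), map_zero]

theorem regularRep_mul_entry (f g : T.Cc) (β γ : G) :
    (f.regularRep * g.regularRep) (stdVec β) γ = ∑' δ, f.kernel γ δ * g.kernel δ β := by
  change f.regularRep (g.regularRep (stdVec β)) γ = _
  rw [f.regularRep_apply]
  simp only [regularRep_entry]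

end Cc

end Twist

/-! ### Local sections and convolution -/

namespace Twist

variable {S G : Type*} [TopologicalSpace S] [TopGroupoid S] [TopologicalSpace G] [TopGroupoid G]
  {T : Twist S G}

/-- Every point of `G` has a neighbourhood on which the line bundle has a nowhere vanishing
continuous section. -/
theorem exists_local_frame (T : Twist S G) (γ : G) : ∃ U : Set G, IsOpen U ∧ γ ∈ U ∧
    (∃ u : G → S, ContinuousOn u U ∧ ∀ x ∈ U, T.proj (u x) = x) ∧
    ∃ φ : S → ℂ, ContinuousOn φ (T.proj ⁻¹' U) ∧
      (∀ z σ, φ (T.act z σ) = (starRingEnd ℂ) (z : ℂ) * φ σ) ∧ ∀ σ, T.proj σ ∈ U → φ σ ≠ 0 := by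
  classical
  obtain ⟨U, hU, hγ, u, hu, hpu, hemb⟩ := T.locally_trivial γ
  let Φ : U × Circle → S := fun p => T.act p.2 (u p.1)
  have hemb : Topology.IsOpenEmbedding Φ := hemb
  let φ : S → ℂ := Function.extend Φ (fun p => (starRingEnd ℂ) (p.2 : ℂ)) 0
  have hφ : ∀ x z, φ (T.act z (u x)) = (starRingEnd ℂ) (z : ℂ) := fun x z =>
    hemb.injective.extend_apply _ _ (x, z)
  have hex : ∀ σ, (h : T.proj σ ∈ U) → ∃ z, σ = T.act z (u ⟨T.proj σ, h⟩) := fun σ h =>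
    T.exists_eq_act (by rw [hpu])
  refine ⟨U, hU, hγ, ⟨fun x => if h : x ∈ U then u ⟨x, h⟩ else u ⟨γ, hγ⟩, ?_, ?_⟩, φ, ?_, ?_, ?_⟩
  · rw [continuousOn_iff_continuous_domRestrict]
    convert hu using 1
    funext x
    simp
  · intro x hx
    simp [hx, hpu]
  · intro σ hσ
    obtain ⟨z, hz⟩ := hex σ hσ
    have h1 : Φ (⟨T.proj σ, hσ⟩, z) = σ := hz.symm
    have h2 : ContinuousAt φ (Φ (⟨T.proj σ, hσ⟩, z)) := by
      rw [← hemb.continuousAt_iff]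
      have h3 : φ ∘ Φ = fun p => (starRingEnd ℂ) (p.2 : ℂ) := funext fun p => hφ p.1 p.2
      rw [h3]
      fun_prop
    rw [h1] at h2
    exact h2.continuousWithinAt
  · intro w σ
    by_cases h : T.proj σ ∈ U
    · obtain ⟨z, hz⟩ := hex σ h
      rw [hz, T.act_act, hφ, hφ, Circle.coe_mul, map_mul]
    · have key : ∀ τ, T.proj τ ∉ U → φ τ = 0 := fun τ hτ => by
        refine Function.extend_apply' _ _ _ ?_
        rintro ⟨⟨x, z⟩, rfl⟩
        apply hτ
        rw [T.proj_act, hpu]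
        exact x.2
      rw [key σ h, key _ (by rwa [T.proj_act]), mul_zero]
  · intro σ h
    obtain ⟨z, hz⟩ := hex σ h
    rw [hz, hφ]
    simp

namespace Cc

/-- Given a point `γ` of an open set `W`, there is a section supported in `W` which does not vanish
at `γ`. -/
theorem exists_ne_zero [T2Space G] [LocallyCompactSpace G] (T : Twist S G) {W : Set G}
    (hW : IsOpen W) {γ : G} (hγ : γ ∈ W) :
    ∃ f : T.Cc, (∀ σ ∈ tsupport f.toFun, T.proj σ ∈ W) ∧ ∀ σ, T.proj σ = γ → f.toFun σ ≠ 0 := by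
  obtain ⟨U, hU, hγU, ⟨u, hu, hpu⟩, φ, hφ, hact, hne⟩ := T.exists_local_frame γ
  obtain ⟨ψ, hψ1, hψc, hψ, -⟩ := exists_continuousMap_one_of_isCompact_subset_isOpen
    (isCompact_singleton (x := γ)) (hU.inter hW) (Set.singleton_subset_iff.2 ⟨hγU, hγ⟩)
  let ψ' : G → ℂ := fun x => (ψ x : ℂ)
  have hψ' : tsupport ψ' ⊆ tsupport ψ := by
    refine closure_mono fun x hx hx' => hx ?_
    change ((ψ x : ℝ) : ℂ) = 0
    rw [hx', Complex.ofReal_zero]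
  have hψU : tsupport ψ' ⊆ U := fun x hx => (hψ (hψ' hx)).1
  have hcont : Continuous ψ' := Complex.continuous_ofReal.comp ψ.continuous
  have hsupp : tsupport (fun σ => ψ' (T.proj σ) * φ σ) ⊆ T.proj ⁻¹' tsupport ψ' :=
    tsupport_mul_subset_left.trans (tsupport_comp_subset_preimage ψ' T.continuous_proj)
  refine ⟨⟨fun σ => ψ' (T.proj σ) * φ σ, ?_, ?_, ?_⟩, ?_, ?_⟩
  · refine continuous_of_tsupport fun σ hσ => ?_
    have hU' : T.proj ⁻¹' U ∈ nhds σ :=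
      (hU.preimage T.continuous_proj).mem_nhds (hψU (hsupp hσ))
    exact (hcont.comp T.continuous_proj).continuousAt.mul (hφ.continuousAt hU')
  · have hK : IsCompact (tsupport ψ') := hψc.of_isClosed_subset isClosed_closure hψ'
    exact (T.isCompact_preimage_of_subset hK hu hpu hψU).of_isClosed_subset isClosed_closure hsupp
  · intro z σ
    simp only [T.proj_act, hact]
    ring
  · exact fun σ hσ => (hψ (hψ' (hsupp hσ))).2
  · rintro σ rfl
    have h1 : ψ' (T.proj σ) = 1 := by
      change ((ψ (T.proj σ) : ℝ) : ℂ) = 1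
      rw [hψ1 rfl]
      simp
    change ψ' (T.proj σ) * φ σ ≠ 0
    rw [h1, one_mul]
    exact hne σ hγU

/-- The convolution of `f` and `g`, for `f` supported over a set `U` on which the range map is
injective: `(f * g)(σ) = f τ g (τ⁻¹ σ)` for any `τ` over `U` with the same range as `σ`. -/
theorem exists_conv_of_injOn [T2Space S] [T2Space G] [IsEtale G] (f g : T.Cc) {U : Set G}
    (hU : IsOpen U) (hinj : Set.InjOn rng U) (hf : ∀ σ ∈ tsupport f.toFun, T.proj σ ∈ U) :
    ∃ h : T.Cc, h.regularRep = f.regularRep * g.regularRep ∧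
      Function.support h.toFun ⊆ mulSet (tsupport f.toFun) (tsupport g.toFun) := by
  classical
  let P : S → Prop := fun σ => ∃ τ, T.proj τ ∈ U ∧ rng τ = rng σ
  let h : S → ℂ := fun σ => if hσ : P σ then f.toFun hσ.choose * g.toFun (mul (inv hσ.choose) σ)
    else 0
  have hP : ∀ σ, ¬ P σ → h σ = 0 := fun σ hσ => dif_neg hσ
  have key : ∀ σ τ, T.proj τ ∈ U → rng τ = rng σ →
      h σ = f.toFun τ * g.toFun (mul (inv τ) σ) := by
    intro σ τ hτ hr
    have hσ : P σ := ⟨τ, hτ, hr⟩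
    have h1 : h σ = f.toFun hσ.choose * g.toFun (mul (inv hσ.choose) σ) := dif_pos hσ
    rw [h1]
    obtain ⟨h2, h3⟩ := hσ.choose_spec
    obtain ⟨z, hz⟩ := T.exists_eq_act (hinj h2 hτ (by rw [← T.proj_rng, ← T.proj_rng, h3, hr]))
    rw [hz, f.map_act, T.inv_act, T.act_mul _ (by rw [src_inv, hr]), g.map_act,
      mul_mul_mul_comm, conj_mul_conj_inv, one_mul]
  have hsupp : Function.support h ⊆ mulSet (tsupport f.toFun) (tsupport g.toFun) := by
    intro σ hσ
    by_cases hPσ : P σ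
    · obtain ⟨τ, hτ, hr⟩ := hPσ
      rw [Function.mem_support, key σ τ hτ hr] at hσ
      refine ⟨(τ, mul (inv τ) σ), ⟨?_, subset_tsupport _ (left_ne_zero_of_mul hσ),
        subset_tsupport _ (right_ne_zero_of_mul hσ)⟩, ?_⟩
      · change src τ = rng _
        rw [rng_mul _ _ (by rw [src_inv, hr]), rng_inv]
      · exact mul_inv_cancel_left hr
    · exact absurd (hP σ hPσ) hσ
  have hact : ∀ z σ, h (T.act z σ) = (starRingEnd ℂ) (z : ℂ) * h σ := by
    intro z σ
    by_cases hPσ : P σ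
    · obtain ⟨τ, hτ, hr⟩ := hPσ
      rw [key σ τ hτ hr, key _ τ hτ (by rw [T.rng_act, hr]),
        T.mul_act _ (by rw [src_inv, hr]), g.map_act]
      ring
    · rw [hP σ hPσ, hP _ (by simpa only [P, T.rng_act] using hPσ), mul_zero]
  have hcont : Continuous h := by
    rw [continuous_iff_continuousAt]
    intro σ
    by_cases hPσ : P σ
    · obtain ⟨τ, hτ, hr⟩ := hPσ
      obtain ⟨V, hV, hηV, t, ht, htV⟩ := T.exists_continuousOn_rng_section hU hτ
      let r : S → G := fun σ => rng (T.proj σ)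
      have hrc : Continuous r := continuous_rng.comp T.continuous_proj
      have hσV : r ⁻¹' V ∈ nhds σ := by
        refine (hV.preimage hrc).mem_nhds ?_
        change rng _ ∈ V
        rwa [← T.proj_rng, ← hr, T.proj_rng]
      have htr : ∀ ρ ∈ r ⁻¹' V, rng (t (r ρ)) = rng ρ := fun ρ hρ =>
        T.rng_eq_of_proj (htV _ hρ).2
      have htc : ContinuousOn (fun ρ => t (r ρ)) (r ⁻¹' V) :=
        ht.comp hrc.continuousOn fun ρ hρ => hρ
      have h1 : ContinuousOn
          (fun ρ => f.toFun (t (r ρ)) * g.toFun (mul (inv (t (r ρ))) ρ)) (r ⁻¹' V) := by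
        refine (f.continuous_toFun.comp_continuousOn htc).mul
          (g.continuous_toFun.comp_continuousOn ?_)
        refine continuousOn_arrowMul.comp (f := fun ρ => (inv (t (r ρ)), ρ))
          ((continuous_arrowInv.comp_continuousOn htc).prodMk continuousOn_id) fun ρ hρ => ?_
        change src (inv _) = rng ρ
        rw [src_inv, htr ρ hρ]
      refine (h1.continuousAt hσV).congr ?_
      filter_upwards [hσV] with ρ hρ
      exact (key ρ _ (htV _ hρ).1 (htr ρ hρ)).symm
    · -- the range of `σ` is outside the compact set of ranges of arrows in the support of `f`
      have hK : IsClosed (rng '' tsupport f.toFun) :=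
        (f.hasCompactSupport.isCompact.image continuous_rng).isClosed
      have hσ : rng ⁻¹' (rng '' tsupport f.toFun)ᶜ ∈ nhds σ := by
        refine (hK.isOpen_compl.preimage continuous_rng).mem_nhds ?_
        rintro ⟨τ, hτ, hr⟩
        exact hPσ ⟨τ, hf τ hτ, hr⟩
      refine (continuousAt_const (y := (0 : ℂ))).congr ?_
      filter_upwards [hσ] with ρ hρ
      by_contra hne
      obtain ⟨⟨τ, τ'⟩, ⟨hc, hτ, -⟩, rfl⟩ := hsupp (Ne.symm hne)
      exact hρ ⟨τ, hτ, (rng_mul _ _ hc).symm⟩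
  refine ⟨⟨h, hcont, HasCompactSupport.intro' (isCompact_mulSet f.hasCompactSupport.isCompact
    g.hasCompactSupport.isCompact) (isCompact_mulSet f.hasCompactSupport.isCompact
    g.hasCompactSupport.isCompact).isClosed fun σ hσ => ?_, hact⟩, ?_, hsupp⟩
  · by_contra hne
    exact hσ (hsupp hne)
  refine clm_ext_entry fun β γ => ?_
  rw [regularRep_mul_entry, regularRep_entry]
  have hU' : ∀ δ, f.kernel γ δ ≠ 0 → src γ = src δ ∧ mul γ (inv δ) ∈ U := fun δ hδ => by
    obtain ⟨h1, τ, hτ, h2⟩ := kernel_ne_zero hδ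
    exact ⟨h1, h2 ▸ hf τ hτ⟩
  by_cases hPγ : P (T.lift γ)
  · obtain ⟨τ, hτ, hr⟩ := hPγ
    have hr' : rng (T.proj τ) = rng γ := by rw [← T.proj_rng, hr, T.proj_rng, proj_lift]
    have hc : src (inv (T.proj τ)) = rng γ := by rw [src_inv, hr']
    have hcτ : src (inv τ) = rng (T.lift γ) := by rw [src_inv, hr]
    have hδs : src (mul (inv (T.proj τ)) γ) = src γ := src_mul _ _ hc
    rw [tsum_eq_single (mul (inv (T.proj τ)) γ)]
    · by_cases hs : src γ = src β
      · have hδ : T.proj (T.lift (mul (inv (T.proj τ)) γ)) =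
            T.proj (mul (inv τ) (T.lift γ)) := by
          rw [proj_lift, T.proj_mul _ _ hcτ, T.proj_inv, proj_lift]
        obtain ⟨w, hw⟩ := T.exists_eq_act hδ
        rw [kernel_of_eq _ hs, kernel_of_eq _ hδs.symm, kernel_of_eq _ (hδs.trans hs), hw]
        have hτs : src (T.lift γ) = rng (mul (inv (T.lift γ)) τ) := by
          rw [rng_mul _ _ (by rw [src_inv, hr]), rng_inv]
        rw [T.inv_act, inv_mul_rev hcτ, TopGroupoid.inv_inv, T.mul_act _ hτs,
          mul_inv_cancel_left hr.symm, f.map_act,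
          T.act_mul _ (by rw [src_mul _ _ hcτ, src_lift_eq_rng_inv hs]), g.map_act,
          mul_mul_mul_comm, conj_inv_mul_conj, one_mul,
          TopGroupoid.mul_assoc _ _ _ hcτ (src_lift_eq_rng_inv hs)]
        exact key _ τ hτ (by rw [rng_mul _ _ (src_lift_eq_rng_inv hs), hr])
      · rw [kernel_of_ne _ hs, kernel_of_ne g (by rwa [hδs]), mul_zero]
    · intro δ hδ
      by_contra hne
      obtain ⟨h1, h2⟩ := hU' δ (left_ne_zero_of_mul hne)
      have h3 := hinj h2 hτ (by rw [rng_mul _ _ (by rw [rng_inv, h1]), hr'])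
      refine hδ ?_
      rw [← h3, inv_mul_rev (by rw [rng_inv, h1]), TopGroupoid.inv_inv]
      exact (mul_inv_cancel_right h1.symm).symm
  · have h0 : ∀ δ, f.kernel γ δ = 0 := fun δ => by
      by_contra hne
      obtain ⟨h1, h2⟩ := hU' δ hne
      refine hPγ ⟨mul (T.lift γ) (inv (T.lift δ)), ?_, rng_mul _ _ (src_lift_eq_rng_inv h1)⟩
      rwa [proj_lift_mul_inv h1]
    simp only [h0, zero_mul, tsum_zero]
    by_cases hs : src γ = src β
    · rw [kernel_of_eq _ hs]
      refine hP _ ?_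
      rintro ⟨τ, hτ, hr⟩
      exact hPγ ⟨τ, hτ, by rw [hr, rng_mul _ _ (src_lift_eq_rng_inv hs)]⟩
    · exact kernel_of_ne _ hs

/-- The convolution of two sections. A partition of unity reduces the claim to sections supported
over sets on which the range map is injective. -/
theorem exists_conv [T2Space S] [T2Space G] [LocallyCompactSpace G] [IsEtale G] (f g : T.Cc) :
    ∃ h : T.Cc, h.regularRep = f.regularRep * g.regularRep := by
  choose U hU hγU hinj using fun γ : G => IsEtale.exists_injOn_rng γ
  have hK : IsCompact (T.proj '' tsupport f.toFun) :=
    f.hasCompactSupport.isCompact.image T.continuous_proj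
  obtain ⟨t, ht⟩ := hK.elim_finite_subcover U hU fun γ _ => Set.mem_iUnion.2 ⟨γ, hγU γ⟩
  let s : Fin t.card → Set G := fun i => U (t.equivFin.symm i)
  obtain ⟨ψ, hψs, hψ1, -⟩ := exists_continuous_sum_one_of_isOpen_isCompact (s := s)
    (fun i => hU _) hK (by
      intro x hx
      obtain ⟨γ, hγ, hx⟩ := Set.mem_iUnion₂.1 (ht hx)
      exact Set.mem_iUnion.2 ⟨t.equivFin ⟨γ, hγ⟩, by simpa [s] using hx⟩)
  have hc : ∀ i, Continuous fun x => (ψ i x : ℂ) := fun i =>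
    Complex.continuous_ofReal.comp (ψ i).continuous
  have hcs : ∀ J : Finset (Fin t.card), Continuous fun x => ∑ i ∈ J, (ψ i x : ℂ) := fun J =>
    continuous_finsetSum J fun i _ => hc i
  have step : ∀ J : Finset (Fin t.card), ∃ h : T.Cc, h.regularRep =
      (f.mulFun _ (hcs J)).regularRep * g.regularRep := by
    classical
    intro J
    induction J using Finset.induction_on with
    | empty =>
      refine ⟨zero T, ?_⟩
      have h0 : f.mulFun _ (hcs ∅) = zero T := by
        simp [mulFun, zero]
        rfl
      rw [h0, regularRep_zero, zero_mul]
    | insert i J hi ih =>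
      obtain ⟨h, hh⟩ := ih
      obtain ⟨h', hh', -⟩ := exists_conv_of_injOn (f.mulFun _ (hc i)) g (hU _) (hinj _)
        fun σ hσ => hψs i (closure_mono (by intro x hx; simpa using hx)
          (proj_mem_of_mem_tsupport_mulFun hσ))
      refine ⟨h'.add h, ?_⟩
      have hadd : f.mulFun _ (hcs (insert i J)) = (f.mulFun _ (hc i)).add (f.mulFun _ (hcs J)) := by
        simp only [mulFun, add, Finset.sum_insert hi, add_mul]
        rfl
      rw [hadd, regularRep_add, regularRep_add, add_mul, hh, hh']
  obtain ⟨h, hh⟩ := step Finset.univ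
  refine ⟨h, hh.trans ?_⟩
  congr 2
  have : (fun σ => (∑ i, (ψ i (T.proj σ) : ℂ)) * f.toFun σ) = f.toFun := by
    funext σ
    by_cases hσ : f.toFun σ = 0
    · rw [hσ, mul_zero]
    · have h1 := hψ1 ⟨σ, subset_tsupport _ hσ, rfl⟩
      simp only [Finset.sum_apply, Pi.one_apply] at h1
      rw [← Complex.ofReal_sum, h1, Complex.ofReal_one, one_mul]
  simp only [mulFun, this]

section Range

variable [T2Space S] [T2Space G] [LocallyCompactSpace G] [IsEtale G]

variable (T) in
/-- The image of `C_c(Σ; G)` under the left regular representation is a *-algebra. -/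
noncomputable def regularRepRange :
    NonUnitalStarSubalgebra ℂ (lp (fun _ : G => ℂ) 2 →L[ℂ] lp (fun _ : G => ℂ) 2) where
  carrier := Set.range fun f : T.Cc => f.regularRep
  add_mem' := by
    rintro _ _ ⟨f, rfl⟩ ⟨g, rfl⟩
    exact ⟨f.add g, regularRep_add f g⟩
  zero_mem' := ⟨zero T, regularRep_zero⟩
  mul_mem' := by
    rintro _ _ ⟨f, rfl⟩ ⟨g, rfl⟩
    obtain ⟨h, hh⟩ := exists_conv f g
    exact ⟨h, hh⟩
  smul_mem' := by
    rintro c _ ⟨f, rfl⟩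
    exact ⟨_, regularRep_smul c f⟩
  star_mem' := by
    rintro _ ⟨f, rfl⟩
    exact ⟨f.conjInv, regularRep_conjInv f⟩

/-- `C*_r(Σ; G)` is the norm closure of the image of `C_c(Σ; G)`. -/
theorem mem_reducedCStar_iff {a : lp (fun _ : G => ℂ) 2 →L[ℂ] lp (fun _ : G => ℂ) 2} :
    a ∈ T.reducedCStar ↔ a ∈ closure (Set.range fun f : T.Cc => f.regularRep) := by
  have h : NonUnitalStarAlgebra.adjoin ℂ (Set.range fun f : T.Cc => f.regularRep) =
      regularRepRange T :=
    le_antisymm (NonUnitalStarAlgebra.adjoin_le fun a ha => ha)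
      fun a ha => NonUnitalStarAlgebra.subset_adjoin ℂ _ ha
  unfold reducedCStar
  rw [h]
  rfl

end Range

theorem regularRep_mem [IsEtale G] (f : T.Cc) : f.regularRep ∈ T.reducedCStar := f.toReduced.2

end Cc

theorem isClosed_reducedCStar [IsEtale G] : 
    IsClosed (T.reducedCStar : Set (lp (fun _ : G => ℂ) 2 →L[ℂ] lp (fun _ : G => ℂ) 2)) :=
  NonUnitalStarSubalgebra.isClosed_topologicalClosure _

end Twist

/-! ### Symbols of operators and compression to an open subgroupoid -/

namespace Twist

section Symbol

variable {S G : Type*} [TopologicalSpace S] [TopGroupoid S] [TopologicalSpace G] [TopGroupoid G]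
  (T : Twist S G)

theorem exists_lift_mul_inv_lift_src (σ : S) : ∃ z : Circle,
    mul (T.lift (T.proj σ)) (inv (T.lift (src (T.proj σ)))) = T.act z σ :=
  T.exists_eq_act (by rw [proj_lift_mul_inv (src_src _).symm, mul_inv_src])

/-- The phase by which `σ` differs from the arrow at which the kernel of a convolution operator
is evaluated to obtain the entry at `(q σ, s (q σ))`. -/
noncomputable def phase (σ : S) : Circle := (T.exists_lift_mul_inv_lift_src σ).choose

theorem phase_spec (σ : S) :
    mul (T.lift (T.proj σ)) (inv (T.lift (src (T.proj σ)))) = T.act (T.phase σ) σ :=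
  (T.exists_lift_mul_inv_lift_src σ).choose_spec

/-- The section of the line bundle attached to an operator on `ℓ²(G)`, read off from its matrix
entries in the columns indexed by units.  On convolution operators this is the inverse of the left
regular representation. -/
noncomputable def symbol (a : ℓ²(G) →L[ℂ] ℓ²(G)) (σ : S) : ℂ :=
  T.phase σ * a (stdVec (src (T.proj σ))) (T.proj σ)

theorem norm_symbol_sub_le (a b : ℓ²(G) →L[ℂ] ℓ²(G)) (σ : S) :
    ‖T.symbol a σ - T.symbol b σ‖ ≤ ‖a - b‖ := by
  have h : T.symbol a σ - T.symbol b σ =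
      T.phase σ * (a - b) (stdVec (src (T.proj σ))) (T.proj σ) := (mul_sub _ _ _).symm
  rw [h, norm_mul, Circle.norm_coe, one_mul]
  exact norm_entry_le _ _ _

theorem continuous_symbol_apply (σ : S) :
    Continuous fun a : ℓ²(G) →L[ℂ] ℓ²(G) => T.symbol a σ :=
  continuous_const.mul (continuous_entry _ _)

variable [IsEtale G]
variable {T}

theorem symbol_regularRep (f : T.Cc) : T.symbol f.regularRep = f.toFun := by
  funext σ
  rw [symbol, Cc.regularRep_entry, Cc.kernel_of_eq _ (src_src _).symm, phase_spec, f.map_act,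
    ← _root_.mul_assoc, ← Circle.coe_inv_eq_conj, ← Circle.coe_mul, mul_inv_cancel,
    Circle.coe_one, one_mul]

variable [T2Space S] [T2Space G] [LocallyCompactSpace G]

theorem continuous_symbol {a : ℓ²(G) →L[ℂ] ℓ²(G)} (ha : a ∈ T.reducedCStar) :
    Continuous (T.symbol a) := by
  rw [Cc.mem_reducedCStar_iff, Metric.mem_closure_iff] at ha
  refine continuous_of_uniform_approx_of_continuous fun u hu => ?_
  obtain ⟨ε, hε, hεu⟩ := Metric.mem_uniformity_dist.1 hu
  obtain ⟨_, ⟨f, rfl⟩, hf⟩ := ha ε hε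
  refine ⟨T.symbol f.regularRep, by rw [symbol_regularRep]; exact f.continuous_toFun,
    fun σ => hεu ?_⟩
  rw [dist_eq_norm] at hf ⊢
  exact (T.norm_symbol_sub_le _ _ σ).trans_lt hf

theorem entry_eq_symbol {a : ℓ²(G) →L[ℂ] ℓ²(G)} (ha : a ∈ T.reducedCStar) {β γ : G}
    (h : src γ = src β) :
    a (stdVec β) γ = T.symbol a (mul (T.lift γ) (inv (T.lift β))) := by
  have hc : IsClosed {a : ℓ²(G) →L[ℂ] ℓ²(G) |
      a (stdVec β) γ = T.symbol a (mul (T.lift γ) (inv (T.lift β)))} :=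
    isClosed_eq (continuous_entry _ _) (T.continuous_symbol_apply _)
  refine closure_minimal ?_ hc (Cc.mem_reducedCStar_iff.1 ha)
  rintro _ ⟨f, rfl⟩
  change f.regularRep _ _ = _
  rw [symbol_regularRep, Cc.regularRep_entry, Cc.kernel_of_eq _ h]

theorem entry_eq_zero {a : ℓ²(G) →L[ℂ] ℓ²(G)} (ha : a ∈ T.reducedCStar) {β γ : G}
    (h : src γ ≠ src β) : a (stdVec β) γ = 0 := by
  have hc : IsClosed {a : ℓ²(G) →L[ℂ] ℓ²(G) | a (stdVec β) γ = 0} :=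
    isClosed_eq (continuous_entry _ _) continuous_const
  refine closure_minimal ?_ hc (Cc.mem_reducedCStar_iff.1 ha)
  rintro _ ⟨f, rfl⟩
  change f.regularRep _ _ = _
  rw [Cc.regularRep_entry, Cc.kernel_of_ne _ h]

/-- An element of `C*_r(Σ; G)` is determined by its columns indexed by units. -/
theorem eq_zero_of_unit_columns {a : ℓ²(G) →L[ℂ] ℓ²(G)} (ha : a ∈ T.reducedCStar)
    (h : ∀ x, rng x = x → a (stdVec x) = 0) : a = 0 := by
  refine clm_ext_entry fun β γ => ?_
  change _ = (0 : ℂ)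
  by_cases hs : src γ = src β
  · rw [entry_eq_symbol ha hs, symbol, h _ (rng_src _)]
    exact mul_zero _
  · exact entry_eq_zero ha hs

end Symbol

section Restriction

variable {S G : Type*} [TopologicalSpace S] [TopGroupoid S] [TopologicalSpace G] [TopGroupoid G]
  (T : Twist S G) (H : OpenSubgroupoid G)

theorem exists_lift_eq_act (h : H.carrier) :
    ∃ z : Circle, T.lift h.1 = T.act z ((T.restrict H).lift h).1 :=
  T.exists_eq_act (by
    rw [proj_lift]
    exact (congrArg Subtype.val ((T.restrict H).proj_lift h)).symm)

/-- The phase by which the chosen lifts to `Σ` and to `Σ_H` of an arrow of `H` differ. -/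
noncomputable def liftPhase (h : H.carrier) : Circle := (T.exists_lift_eq_act H h).choose

theorem liftPhase_spec (h : H.carrier) :
    T.lift h.1 = T.act (T.liftPhase H h) ((T.restrict H).lift h).1 :=
  (T.exists_lift_eq_act H h).choose_spec

theorem orthonormal_smul_stdVec :
    Orthonormal ℂ fun h : H.carrier => (starRingEnd ℂ) (T.liftPhase H h : ℂ) • stdVec h.1 := by
  classical
  rw [orthonormal_iff_ite]
  intro h k
  rw [inner_smul_left, inner_smul_right, inner_stdVec_left, Complex.conj_conj]
  split_ifs with hk
  · subst hk
    rw [stdVec_self, mul_one, ← Circle.coe_inv_eq_conj, ← Circle.coe_mul, mul_inv_cancel,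
      Circle.coe_one]
  · rw [stdVec_ne fun hh => hk (Subtype.ext hh), mul_zero, mul_zero]

/-- The inclusion of square-summable sections over `H` into those over `G`, as an isometry
`ℓ²(H) → ℓ²(G)`; the phases account for the different choices of lifts to `Σ`. -/
noncomputable def incl₂ : ℓ²(H.carrier) →L[ℂ] ℓ²(G) :=
  (T.orthonormal_smul_stdVec H).orthogonalFamily.linearIsometry.toContinuousLinearMap

theorem incl₂_stdVec (h : H.carrier) :
    T.incl₂ H (stdVec h) = (starRingEnd ℂ) (T.liftPhase H h : ℂ) • stdVec h.1 := by
  classical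
  have h1 : stdVec h = lp.single (E := fun _ => ℂ) 2 h 1 := by
    unfold stdVec
    congr
    exact Subsingleton.elim _ _
  rw [h1]
  refine ((T.orthonormal_smul_stdVec H).orthogonalFamily.linearIsometry_apply_single 1).trans ?_
  simp

theorem adjoint_incl₂_mul : (T.incl₂ H).adjoint ∘L T.incl₂ H = 1 :=
  ContinuousLinearMap.ext fun ξ => by
    refine ext_inner_left ℂ fun η => ?_
    change inner ℂ η ((T.incl₂ H).adjoint (T.incl₂ H ξ)) = inner ℂ η ξ
    rw [ContinuousLinearMap.adjoint_inner_right]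
    exact LinearIsometry.inner_map_map _ _ _

theorem norm_incl₂_le : ‖T.incl₂ H‖ ≤ 1 :=
  LinearIsometry.norm_toContinuousLinearMap_le _

theorem stdVec_eq_incl₂ (h : H.carrier) :
    stdVec h.1 = T.incl₂ H ((T.liftPhase H h : ℂ) • stdVec h) := by
  rw [map_smul, incl₂_stdVec, smul_smul, ← Circle.coe_inv_eq_conj, ← Circle.coe_mul,
    mul_inv_cancel, Circle.coe_one, one_smul]

theorem adjoint_incl₂_stdVec (h : H.carrier) :
    (T.incl₂ H).adjoint (stdVec h.1) = (T.liftPhase H h : ℂ) • stdVec h := by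
  rw [T.stdVec_eq_incl₂ H h]
  exact DFunLike.congr_fun (T.adjoint_incl₂_mul H) _

theorem adjoint_incl₂_stdVec_of_notMem {γ : G} (h : γ ∉ H.carrier) :
    (T.incl₂ H).adjoint (stdVec γ) = 0 := by
  ext k
  rw [adjoint_entry, incl₂_stdVec]
  change (starRingEnd ℂ) (_ * stdVec k.1 γ) = 0
  have hk : γ ≠ k.1 := fun hk => h (hk ▸ k.2)
  rw [stdVec_ne hk, mul_zero, map_zero]

theorem incl₂_apply (ξ : ℓ²(H.carrier)) (h : H.carrier) :
    T.incl₂ H ξ h.1 = (starRingEnd ℂ) (T.liftPhase H h : ℂ) * ξ h := by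
  rw [← inner_stdVec_left, ← ContinuousLinearMap.adjoint_inner_left, adjoint_incl₂_stdVec,
    inner_smul_left, inner_stdVec_left]

theorem incl₂_apply_of_notMem (ξ : ℓ²(H.carrier)) {γ : G} (h : γ ∉ H.carrier) :
    T.incl₂ H ξ γ = 0 := by
  rw [← inner_stdVec_left, ← ContinuousLinearMap.adjoint_inner_left,
    adjoint_incl₂_stdVec_of_notMem T H h, inner_zero_left]

/-- The compression of an operator on `ℓ²(G)` to `ℓ²(H)`. -/
noncomputable def compress (a : ℓ²(G) →L[ℂ] ℓ²(G)) : ℓ²(H.carrier) →L[ℂ] ℓ²(H.carrier) :=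
  (T.incl₂ H).adjoint ∘L a ∘L T.incl₂ H

theorem compress_apply (a : ℓ²(G) →L[ℂ] ℓ²(G)) (ξ : ℓ²(H.carrier)) :
    T.compress H a ξ = (T.incl₂ H).adjoint (a (T.incl₂ H ξ)) := rfl

theorem compress_add (a b : ℓ²(G) →L[ℂ] ℓ²(G)) :
    T.compress H (a + b) = T.compress H a + T.compress H b := by
  ext1 ξ
  simp [compress_apply]

theorem compress_smul (c : ℂ) (a : ℓ²(G) →L[ℂ] ℓ²(G)) :
    T.compress H (c • a) = c • T.compress H a := by
  ext1 ξ
  simp [compress_apply]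

theorem compress_star (a : ℓ²(G) →L[ℂ] ℓ²(G)) :
    T.compress H (star a) = star (T.compress H a) := by
  simp only [compress, ContinuousLinearMap.star_eq_adjoint, ContinuousLinearMap.adjoint_comp,
    ContinuousLinearMap.adjoint_adjoint, ContinuousLinearMap.comp_assoc]

theorem norm_compress_le (a : ℓ²(G) →L[ℂ] ℓ²(G)) : ‖T.compress H a‖ ≤ ‖a‖ := by
  refine (ContinuousLinearMap.opNorm_comp_le _ _).trans ?_
  refine (mul_le_mul_of_nonneg_left (ContinuousLinearMap.opNorm_comp_le _ _)
    (norm_nonneg _)).trans ?_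
  rw [LinearIsometryEquiv.norm_map]
  have h := T.norm_incl₂_le H
  have h0 := norm_nonneg (T.incl₂ H)
  calc ‖T.incl₂ H‖ * (‖a‖ * ‖T.incl₂ H‖) ≤ 1 * (‖a‖ * 1) := by gcongr
    _ = ‖a‖ := by ring

theorem continuous_compress : Continuous (T.compress H) := by
  unfold compress
  fun_prop

theorem compress_congr {a b : ℓ²(G) →L[ℂ] ℓ²(G)}
    (h : ∀ β ∈ H.carrier, ∀ γ ∈ H.carrier, a (stdVec β) γ = b (stdVec β) γ) :
    T.compress H a = T.compress H b := by
  have key : ∀ (a : ℓ²(G) →L[ℂ] ℓ²(G)) (β γ : H.carrier), T.compress H a (stdVec β) γ =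
      (T.liftPhase H γ : ℂ) * ((starRingEnd ℂ) (T.liftPhase H β : ℂ) * a (stdVec β.1) γ.1) := by
    intro a β γ
    rw [compress_apply, ← inner_stdVec_left, ContinuousLinearMap.adjoint_inner_right,
      incl₂_stdVec, incl₂_stdVec, inner_smul_left, Complex.conj_conj, map_smul, inner_smul_right,
      inner_stdVec_left]
  exact clm_ext_entry fun β γ => by rw [key, key, h _ β.2 _ γ.2]

end Restriction

end Twist

/-! ### Two facts about C*-algebras -/

/-- If a linear map `E` restricts to an injective *-homomorphism from a C*-subalgebra `B` of `A`
into `C` and `E '' B` is dense in `C`, then it maps `B` isometrically onto `C`, and the inverse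
embeds `C` in `A`. -/
theorem exists_starHom_right_inverse {A₀ C₀ : Type*} [NonUnitalCStarAlgebra A₀]
    [NonUnitalCStarAlgebra C₀] (A B : NonUnitalStarSubalgebra ℂ A₀)
    (C : NonUnitalStarSubalgebra ℂ C₀) (hBA : B ≤ A) (hB : IsClosed (B : Set A₀))
    (hC : IsClosed (C : Set C₀)) (E : A₀ →ₗ[ℂ] C₀) (hEC : ∀ b ∈ B, E b ∈ C)
    (hmul : ∀ a ∈ B, ∀ b ∈ B, E (a * b) = E a * E b) (hstar : ∀ b ∈ B, E (star b) = star (E b))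
    (hinj : ∀ b ∈ B, E b = 0 → b = 0) (hdense : (C : Set C₀) ⊆ closure (E '' B)) :
    ∃ ι : C →⋆ₙₐ[ℂ] A, (∀ c, ‖ι c‖ = ‖c‖) ∧ (∀ c, (ι c : A₀) ∈ B) ∧ ∀ c, E (ι c) = c := by
  let : NonUnitalCStarAlgebra B := NonUnitalStarSubalgebra.nonUnitalCStarAlgebra B
    (h_closed := hB)
  let : NonUnitalCStarAlgebra C := NonUnitalStarSubalgebra.nonUnitalCStarAlgebra C
    (h_closed := hC)
  let φ : B →⋆ₙₐ[ℂ] C :=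
    { toFun := fun b => ⟨E b, hEC b b.2⟩
      map_smul' := fun c b => Subtype.ext (E.map_smul c b)
      map_zero' := Subtype.ext E.map_zero
      map_add' := fun a b => Subtype.ext (E.map_add a b)
      map_mul' := fun a b => Subtype.ext (hmul a a.2 b b.2)
      map_star' := fun b => Subtype.ext (hstar b b.2) }
  have hφ : Function.Injective φ := by
    rw [injective_iff_map_eq_zero]
    exact fun b hb => Subtype.ext (hinj b b.2 (congrArg Subtype.val hb))
  have hnorm : ∀ b : B, ‖E b‖ = ‖(b : A₀)‖ := NonUnitalStarAlgHom.norm_map φ hφ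
  have hi : Isometry fun b : B => E b :=
    isometry_subtype_coe.comp (NonUnitalStarAlgHom.isometry φ hφ)
  have himage : IsClosed (E '' B) := by
    have h : E '' (B : Set A₀) = Set.range fun b : B => E b := by
      ext c
      simp
    rw [h]
    exact hi.isClosedEmbedding.isClosed_range
  have hsurj : ∀ c : C, ∃ b ∈ B, E b = c := fun c => himage.closure_subset (hdense c.2)
  choose g hgB hg using hsurj
  have huniq : ∀ a ∈ B, ∀ b ∈ B, E a = E b → a = b := fun a ha b hb h =>
    sub_eq_zero.1 (hinj _ (sub_mem ha hb) (by rw [map_sub, h, sub_self]))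
  refine ⟨{ toFun := fun c => ⟨g c, hBA (hgB c)⟩, map_smul' := ?_, map_zero' := ?_,
            map_add' := ?_, map_mul' := ?_, map_star' := ?_ }, fun c => ?_, hgB, hg⟩
  · refine fun z c => Subtype.ext (huniq _ (hgB _) (z • g c) (SMulMemClass.smul_mem z (hgB c)) ?_)
    rw [hg, map_smul, hg]
    rfl
  · refine Subtype.ext (huniq _ (hgB _) 0 (zero_mem _) ?_)
    rw [hg, map_zero]
    rfl
  · refine fun c d => Subtype.ext (huniq _ (hgB _) (g c + g d) (add_mem (hgB c) (hgB d)) ?_)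
    rw [hg, map_add, hg, hg]
    rfl
  · refine fun c d => Subtype.ext (huniq _ (hgB _) (g c * g d) (mul_mem (hgB c) (hgB d)) ?_)
    rw [hg, hmul _ (hgB c) _ (hgB d), hg, hg]
    rfl
  · refine fun c => Subtype.ext (huniq _ (hgB _) (star (g c)) (star_mem (hgB c)) ?_)
    rw [hg, hstar _ (hgB c), hg]
    rfl
  · exact (hnorm ⟨g c, hgB c⟩).symm.trans (congrArg norm (hg c))

open ContinuousLinearMap in
/-- A closed *-algebra of operators contains the square roots of its elements of the
form `x* x`. -/
theorem exists_star_mul_self_of_mem {E F : Type*} [NormedAddCommGroup E] [InnerProductSpace ℂ E]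
    [CompleteSpace E] [NormedAddCommGroup F] [InnerProductSpace ℂ F] [CompleteSpace F]
    (C : NonUnitalStarSubalgebra ℂ (E →L[ℂ] E)) (hC : IsClosed (C : Set (E →L[ℂ] E)))
    (x : E →L[ℂ] F) (hx : adjoint x ∘L x ∈ C) : ∃ c ∈ C, adjoint x ∘L x = star c * c := by
  have hpos : 0 ≤ adjoint x ∘L x := by
    rw [nonneg_iff_isPositive]
    exact isPositive_adjoint_comp_self x
  have : IsClosed (C : Set (E →L[ℂ] E)) := hC
  refine ⟨CFC.sqrt (adjoint x ∘L x), ?_, ?_⟩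
  · rw [CFC.sqrt_eq_real_sqrt _ hpos]
    exact cfcₙ_mem (𝕜' := ℂ) _ hx
  · rw [(CFC.sqrt_nonneg _).isSelfAdjoint.star_eq, CFC.sqrt_mul_sqrt_self _ hpos]

/-! ### Operators extended from an open subgroupoid -/

namespace Twist

variable {S G : Type*} [TopologicalSpace S] [TopGroupoid S] [TopologicalSpace G] [TopGroupoid G]
  {T : Twist S G} {H : OpenSubgroupoid G}

namespace Cc

theorem extend_apply [T2Space S] (f : (T.restrict H).Cc) (σ : (T.preimage H).carrier) :
    f.extend.toFun σ.1 = f.toFun σ :=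
  Subtype.val_injective.extend_apply _ _ _

theorem extend_apply_of_notMem [T2Space S] (f : (T.restrict H).Cc) {σ : S}
    (h : T.proj σ ∉ H.carrier) : f.extend.toFun σ = 0 :=
  Function.extend_apply' _ _ _ fun ⟨τ, hτ⟩ => h (hτ ▸ τ.2)

/-- A section supported in `H` is the extension by zero of a section over `H`. -/
theorem exists_extend_eq [T2Space S] (f : T.Cc)
    (hf : ∀ σ ∈ tsupport f.toFun, T.proj σ ∈ H.carrier) :
    ∃ f' : (T.restrict H).Cc, f'.extend = f := by
  refine ⟨⟨fun σ => f.toFun σ.1, f.continuous_toFun.comp continuous_subtype_val, ?_, ?_⟩, ?_⟩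
  · refine (Topology.IsInducing.subtypeVal.isCompact_preimage' f.hasCompactSupport.isCompact
      ?_).of_isClosed_subset isClosed_closure
      (tsupport_comp_subset_preimage f.toFun continuous_subtype_val)
    rw [Subtype.range_coe]
    exact hf
  · intro z σ
    rw [← f.map_act]
    exact congrArg f.toFun (OpenSubgroupoid.coe_mul _ _ _ (T.src_incl_rng σ.1 z))
  · have h : ∀ σ, Function.extend Subtype.val
        (fun σ : (T.preimage H).carrier => f.toFun σ.1) 0 σ = f.toFun σ := by
      intro σ
      by_cases hσ : σ ∈ (T.preimage H).carrier
      · exact Subtype.val_injective.extend_apply _ _ ⟨σ, hσ⟩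
      · rw [Function.extend_apply' _ _ _ fun ⟨τ, hτ⟩ => hσ (hτ ▸ τ.2)]
        by_contra hne
        exact hσ (hf σ (subset_tsupport _ (Ne.symm hne)))
    obtain ⟨f, _, _, _⟩ := f
    simp only [extend, mk.injEq]
    exact funext h

theorem kernel_extend_of_notMem [T2Space S] (f : (T.restrict H).Cc) {γ β : G}
    (hβ : β ∈ H.carrier) (hγ : γ ∉ H.carrier) : f.extend.kernel γ β = 0 := by
  by_cases hs : src γ = src β
  · rw [kernel_of_eq _ hs]
    refine extend_apply_of_notMem f fun hmem => hγ (H.mem_of_mul_inv_mem hs hβ ?_)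
    rwa [proj_lift_mul_inv hs] at hmem
  · exact kernel_of_ne _ hs

theorem kernel_extend [T2Space S] (f : (T.restrict H).Cc) (γ β : H.carrier) :
    (starRingEnd ℂ) (T.liftPhase H β : ℂ) * f.extend.kernel γ.1 β.1 =
      (starRingEnd ℂ) (T.liftPhase H γ : ℂ) * f.kernel γ β := by
  by_cases hs : src γ = src β
  · have hs' : src γ.1 = src β.1 := congrArg Subtype.val hs
    have hc := congrArg Subtype.val ((T.restrict H).src_lift_eq_rng_inv hs)
    change src ((T.restrict H).lift γ).1 = rng (inv ((T.restrict H).lift β).1) at hc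
    have h1 : mul (T.lift γ.1) (inv (T.lift β.1)) =
        T.act (T.liftPhase H γ * (T.liftPhase H β)⁻¹)
          (mul ((T.restrict H).lift γ) (inv ((T.restrict H).lift β))).1 := by
      rw [OpenSubgroupoid.coe_mul _ _ _ hc, OpenSubgroupoid.coe_inv, T.liftPhase_spec,
        T.liftPhase_spec, T.inv_act, T.act_mul _ (by rw [hc, T.rng_act]), T.mul_act _ hc,
        T.act_act]
    rw [kernel_of_eq _ hs, kernel_of_eq _ hs', h1, map_act, extend_apply, Circle.coe_mul, map_mul,
      ← _root_.mul_assoc, mul_left_comm, conj_mul_conj_inv, mul_one]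
  · have hs' : src γ.1 ≠ src β.1 := fun h => hs (Subtype.ext h)
    rw [kernel_of_ne _ hs, kernel_of_ne _ hs', mul_zero, mul_zero]

variable [IsEtale G]

theorem regularRep_extend_comp_incl₂ [T2Space S] (f : (T.restrict H).Cc) :
    f.extend.regularRep ∘L T.incl₂ H = T.incl₂ H ∘L f.regularRep := by
  refine clm_ext_entry fun β γ => ?_
  change f.extend.regularRep (T.incl₂ H (stdVec β)) γ = T.incl₂ H (f.regularRep (stdVec β)) γ
  rw [incl₂_stdVec, map_smul]
  change _ * f.extend.regularRep (stdVec β.1) γ = _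
  rw [regularRep_entry]
  by_cases hγ : γ ∈ H.carrier
  · rw [T.incl₂_apply H _ ⟨γ, hγ⟩, regularRep_entry]
    exact kernel_extend f ⟨γ, hγ⟩ β
  · rw [T.incl₂_apply_of_notMem H _ hγ, kernel_extend_of_notMem f β.2 hγ, mul_zero]

theorem conjInv_extend [T2Space S] (f : (T.restrict H).Cc) :
    f.extend.conjInv.regularRep = f.conjInv.extend.regularRep := by
  have h : f.extend.conjInv.toFun = f.conjInv.extend.toFun := by
    funext σ
    change (starRingEnd ℂ) (f.extend.toFun (inv σ)) = _
    by_cases hσ : T.proj σ ∈ H.carrier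
    · exact (congrArg _ (extend_apply f (inv ⟨σ, hσ⟩))).trans
        (extend_apply f.conjInv ⟨σ, hσ⟩).symm
    · rw [extend_apply_of_notMem f.conjInv hσ, extend_apply_of_notMem f, map_zero]
      rw [T.proj_inv]
      intro h
      apply hσ
      rw [← TopGroupoid.inv_inv (T.proj σ)]
      exact H.inv_mem _ h
  refine clm_ext_entry fun β γ => ?_
  rw [regularRep_entry, regularRep_entry, kernel, kernel, h]

theorem regularRep_extend_stdVec_of_notMem [T2Space S] (f : (T.restrict H).Cc) {x : G}
    (hx : rng x = x) (h : x ∉ H.carrier) : f.extend.regularRep (stdVec x) = 0 := by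
  ext γ
  rw [regularRep_entry]
  change _ = (0 : ℂ)
  by_cases hs : src γ = src x
  · rw [kernel_of_eq _ hs]
    refine extend_apply_of_notMem f fun hmem => h ?_
    have hsx : src γ = x := by rw [hs, ← hx, src_rng]
    rw [proj_lift_mul_inv hs, inv_eq_self_of_rng_eq hx, ← hsx, mul_src_self] at hmem
    rw [← hsx]
    exact H.src_mem hmem
  · exact kernel_of_ne _ hs

theorem compress_regularRep_extend [T2Space S] (f : (T.restrict H).Cc) :
    T.compress H f.extend.regularRep = f.regularRep := by
  rw [compress, regularRep_extend_comp_incl₂, ← ContinuousLinearMap.comp_assoc,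
    adjoint_incl₂_mul]
  rfl

end Cc

theorem compress_mul_of_comp_incl₂ {a b : ℓ²(G) →L[ℂ] ℓ²(G)}
    (hb : b ∘L T.incl₂ H = T.incl₂ H ∘L T.compress H b) :
    T.compress H (a * b) = T.compress H a * T.compress H b := by
  ext1 ξ
  change (T.incl₂ H).adjoint (a (b (T.incl₂ H ξ))) = _
  rw [show b (T.incl₂ H ξ) = T.incl₂ H (T.compress H b ξ) from DFunLike.congr_fun hb ξ]
  rfl

theorem mul_comp_incl₂ {a b : ℓ²(G) →L[ℂ] ℓ²(G)}
    (ha : a ∘L T.incl₂ H = T.incl₂ H ∘L T.compress H a)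
    (hb : b ∘L T.incl₂ H = T.incl₂ H ∘L T.compress H b) :
    (a * b) ∘L T.incl₂ H = T.incl₂ H ∘L T.compress H (a * b) := by
  rw [compress_mul_of_comp_incl₂ hb, ContinuousLinearMap.mul_def, ContinuousLinearMap.mul_def,
    ContinuousLinearMap.comp_assoc, hb, ← ContinuousLinearMap.comp_assoc, ha,
    ContinuousLinearMap.comp_assoc]

theorem compress_mul_of_star_comp_incl₂ {a b : ℓ²(G) →L[ℂ] ℓ²(G)}
    (hb : star b ∘L T.incl₂ H = T.incl₂ H ∘L T.compress H (star b)) :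
    T.compress H (b * a) = T.compress H b * T.compress H a := by
  apply star_injective
  rw [← compress_star, star_mul, compress_mul_of_comp_incl₂ hb, star_mul, compress_star,
    compress_star]

variable [IsEtale G]

variable (T H) in
/-- The elements of `C*_r(Σ; G)` that leave `ℓ²(H)` and its complement invariant, restrict on
`ℓ²(H)` to an element of `C*_r(Σ_H; H)` and, like their adjoints, annihilate the basis vectors at
units outside `H`.  They form the image of `C*_r(Σ_H; H)`. -/
structure IsExtended (b : ℓ²(G) →L[ℂ] ℓ²(G)) : Prop where
  mem : b ∈ T.reducedCStar
  compress_mem : T.compress H b ∈ (T.restrict H).reducedCStar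
  comp_incl₂ : b ∘L T.incl₂ H = T.incl₂ H ∘L T.compress H b
  star_comp_incl₂ : star b ∘L T.incl₂ H = T.incl₂ H ∘L T.compress H (star b)
  apply_unit : ∀ x, rng x = x → x ∉ H.carrier → b (stdVec x) = 0
  star_apply_unit : ∀ x, rng x = x → x ∉ H.carrier → star b (stdVec x) = 0

namespace IsExtended

variable {a b : ℓ²(G) →L[ℂ] ℓ²(G)}

theorem add (ha : T.IsExtended H a) (hb : T.IsExtended H b) : T.IsExtended H (a + b) where
  mem := add_mem ha.mem hb.mem
  compress_mem := by
    rw [compress_add]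
    exact add_mem ha.compress_mem hb.compress_mem
  comp_incl₂ := by
    rw [compress_add, ContinuousLinearMap.add_comp, ContinuousLinearMap.comp_add, ha.comp_incl₂,
      hb.comp_incl₂]
  star_comp_incl₂ := by
    rw [star_add, compress_add, ContinuousLinearMap.add_comp, ContinuousLinearMap.comp_add,
      ha.star_comp_incl₂, hb.star_comp_incl₂]
  apply_unit x hx hxH := by
    rw [add_apply, ha.apply_unit x hx hxH, hb.apply_unit x hx hxH, add_zero]
  star_apply_unit x hx hxH := by
    rw [star_add, add_apply, ha.star_apply_unit x hx hxH, hb.star_apply_unit x hx hxH, add_zero]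

theorem smul (c : ℂ) (ha : T.IsExtended H a) : T.IsExtended H (c • a) where
  mem := SMulMemClass.smul_mem c ha.mem
  compress_mem := by
    rw [compress_smul]
    exact SMulMemClass.smul_mem c ha.compress_mem
  comp_incl₂ := by
    rw [compress_smul, ContinuousLinearMap.smul_comp, ContinuousLinearMap.comp_smul,
      ha.comp_incl₂]
  star_comp_incl₂ := by
    rw [star_smul, compress_smul, ContinuousLinearMap.smul_comp, ContinuousLinearMap.comp_smul,
      ha.star_comp_incl₂]
  apply_unit x hx hxH := by
    rw [smul_apply, ha.apply_unit x hx hxH, smul_zero]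
  star_apply_unit x hx hxH := by
    rw [star_smul, smul_apply, ha.star_apply_unit x hx hxH, smul_zero]

theorem star (ha : T.IsExtended H a) : T.IsExtended H (star a) where
  mem := star_mem ha.mem
  compress_mem := by
    rw [compress_star]
    exact star_mem ha.compress_mem
  comp_incl₂ := ha.star_comp_incl₂
  star_comp_incl₂ := by
    rw [star_star]
    exact ha.comp_incl₂
  apply_unit := ha.star_apply_unit
  star_apply_unit x hx hxH := by
    rw [star_star]
    exact ha.apply_unit x hx hxH

theorem mul (ha : T.IsExtended H a) (hb : T.IsExtended H b) : T.IsExtended H (a * b) where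
  mem := mul_mem ha.mem hb.mem
  compress_mem := by
    rw [compress_mul_of_comp_incl₂ hb.comp_incl₂]
    exact mul_mem ha.compress_mem hb.compress_mem
  comp_incl₂ := mul_comp_incl₂ ha.comp_incl₂ hb.comp_incl₂
  star_comp_incl₂ := by
    rw [star_mul]
    exact mul_comp_incl₂ hb.star_comp_incl₂ ha.star_comp_incl₂
  apply_unit x hx hxH := by
    rw [ContinuousLinearMap.mul_def, ContinuousLinearMap.comp_apply, hb.apply_unit x hx hxH,
      map_zero]
  star_apply_unit x hx hxH := by
    rw [star_mul, ContinuousLinearMap.mul_def, ContinuousLinearMap.comp_apply,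
      ha.star_apply_unit x hx hxH, map_zero]

theorem zero : T.IsExtended H 0 := by
  have h0 : T.compress H 0 = 0 := by
    ext1 ξ
    simp [compress_apply]
  refine ⟨zero_mem _, ?_, ?_, ?_, fun x hx hxH => rfl, fun x hx hxH => ?_⟩
  · rw [h0]
    exact zero_mem _
  · rw [h0, ContinuousLinearMap.zero_comp, ContinuousLinearMap.comp_zero]
  · rw [star_zero, h0, ContinuousLinearMap.zero_comp, ContinuousLinearMap.comp_zero]
  · rw [star_zero]
    rfl

end IsExtended

variable (T H) in
/-- The C*-algebra of operators on `ℓ²(G)` which is the image of `C*_r(Σ_H; H)`. -/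
noncomputable def imageCStar : NonUnitalStarSubalgebra ℂ (ℓ²(G) →L[ℂ] ℓ²(G)) where
  carrier := {b | T.IsExtended H b}
  add_mem' := IsExtended.add
  zero_mem' := IsExtended.zero
  mul_mem' := IsExtended.mul
  smul_mem' c _ := IsExtended.smul c
  star_mem' := IsExtended.star

theorem isExtended_regularRep_extend [T2Space S] (f : (T.restrict H).Cc) :
    T.IsExtended H f.extend.regularRep := by
  have hstar : star f.extend.regularRep = f.conjInv.extend.regularRep := by
    rw [← Cc.regularRep_conjInv, Cc.conjInv_extend]
  refine ⟨Cc.regularRep_mem _, ?_, ?_, ?_, fun x hx hxH => ?_, fun x hx hxH => ?_⟩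
  · rw [Cc.compress_regularRep_extend]
    exact Cc.regularRep_mem _
  · rw [Cc.compress_regularRep_extend]
    exact Cc.regularRep_extend_comp_incl₂ f
  · rw [hstar, Cc.compress_regularRep_extend]
    exact Cc.regularRep_extend_comp_incl₂ _
  · exact Cc.regularRep_extend_stdVec_of_notMem f hx hxH
  · rw [hstar]
    exact Cc.regularRep_extend_stdVec_of_notMem _ hx hxH

theorem isClosed_imageCStar : IsClosed (T.imageCStar H : Set (ℓ²(G) →L[ℂ] ℓ²(G))) := by
  have hE := T.continuous_compress H
  have h1 : Continuous fun b : ℓ²(G) →L[ℂ] ℓ²(G) => b ∘L T.incl₂ H := by fun_prop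
  have h2 : Continuous fun b : ℓ²(G) →L[ℂ] ℓ²(G) => T.incl₂ H ∘L T.compress H b := by fun_prop
  have h3 : ∀ x, IsClosed {b : ℓ²(G) →L[ℂ] ℓ²(G) | b (stdVec x) = 0} := fun x =>
    isClosed_eq (by fun_prop) continuous_const
  have h4 : IsClosed {b : ℓ²(G) →L[ℂ] ℓ²(G) |
      ∀ x, rng x = x → x ∉ H.carrier → b (stdVec x) = 0} := by
    simp only [Set.ofPred_forall]
    exact isClosed_iInter fun x => isClosed_iInter fun _ => isClosed_iInter fun _ => h3 x
  have h5 := (isClosed_reducedCStar (T := T)).inter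
    (((isClosed_reducedCStar (T := T.restrict H)).preimage hE).inter
    ((isClosed_eq h1 h2).inter (((isClosed_eq h1 h2).preimage continuous_star).inter
      (h4.inter (h4.preimage continuous_star)))))
  convert h5 using 1
  ext b
  exact ⟨fun ⟨k1, k2, k3, k4, k5, k6⟩ => ⟨k1, k2, k3, k4, k5, k6⟩,
    fun ⟨k1, k2, k3, k4, k5, k6⟩ => ⟨k1, k2, k3, k4, k5, k6⟩⟩

/-- An element of the image of `C*_r(Σ_H; H)` is a section supported in `H`. -/
theorem symbol_eq_zero_of_notMem {b : ℓ²(G) →L[ℂ] ℓ²(G)} (hb : T.IsExtended H b) {σ : S}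
    (hσ : T.proj σ ∉ H.carrier) : T.symbol b σ = 0 := by
  obtain ⟨-, -, h3, -, h5, -⟩ := hb
  rw [symbol]
  by_cases hx : src (T.proj σ) ∈ H.carrier
  · have h1 := T.stdVec_eq_incl₂ H ⟨_, hx⟩
    rw [h1, show ∀ ξ, b (T.incl₂ H ξ) = T.incl₂ H (T.compress H b ξ) from
      DFunLike.congr_fun h3, T.incl₂_apply_of_notMem H _ hσ, mul_zero]
  · rw [h5 _ (rng_src _) hx]
    exact mul_zero _

end Twist

/-! ### The embedding, and the expectation for closed subgroupoids -/

/-- A contractive linear left inverse `E` of an embedding `ι` which is positive and `ι`-bilinear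
yields the conditional expectation `ι ∘ E`. -/
theorem isConditionalExpectation_comp {A C : Type*} [NonUnitalCStarAlgebra A]
    [NonUnitalCStarAlgebra C] (ι : C →⋆ₙₐ[ℂ] A) (hι : ∀ c, ‖ι c‖ = ‖c‖) (E : A →ₗ[ℂ] C)
    (hE : ∀ c, E (ι c) = c) (hnorm : ∀ a, ‖E a‖ ≤ ‖a‖)
    (hpos : ∀ a, ∃ c, E (star a * a) = star c * c) (hleft : ∀ c a, E (ι c * a) = c * E a)
    (hright : ∀ c a, E (a * ι c) = E a * c) :
    IsConditionalExpectation (NonUnitalStarAlgHom.range ι)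
      ((ι : C →ₗ[ℂ] A) ∘ₗ E) where
  mem a := ⟨E a, rfl⟩
  apply_of_mem := by
    rintro _ ⟨c, rfl⟩
    exact congrArg ι (hE c)
  norm_le a := (hι _).trans_le (hnorm a)
  nonneg a := by
    obtain ⟨c, hc⟩ := hpos a
    refine ⟨ι c, ?_⟩
    change ι (E (star a * a)) = _
    rw [hc, map_mul, map_star]
  map_mul_left := by
    rintro _ ⟨c, rfl⟩ a
    change ι (E (ι c * a)) = ι c * ι (E a)
    rw [hleft, map_mul]
  map_mul_right := by
    rintro _ ⟨c, rfl⟩ a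
    change ι (E (a * ι c)) = ι (E a) * ι c
    rw [hright, map_mul]

/-- A conditional expectation `F` fixes `g* f` whenever `g` and `g* f` are in its range, which
then gives `g* F f = g* f`. -/
theorem IsConditionalExpectation.star_mul_apply {A C : Type*} [NonUnitalCStarAlgebra A]
    [NonUnitalCStarAlgebra C] {ι : C →⋆ₙₐ[ℂ] A} {F : A →ₗ[ℂ] A}
    (hF : IsConditionalExpectation (NonUnitalStarAlgHom.range ι) F) {c d : C} {f g : A}
    (hc : ι c = g) (hd : ι d = star g * f) : star g * F f = star g * f := by
  rw [← hF.map_mul_left _ ⟨star c, (map_star ι c).trans (congrArg star hc)⟩,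
    hF.apply_of_mem _ ⟨d, hd⟩]

namespace Twist

variable {S G : Type*} [TopologicalSpace S] [TopGroupoid S] [TopologicalSpace G] [TopGroupoid G]
  {T : Twist S G} {H : OpenSubgroupoid G}

variable [IsEtale G] [T2Space S] [T2Space G] [LocallyCompactSpace G]

theorem IsExtended.eq_zero {b : ℓ²(G) →L[ℂ] ℓ²(G)} (hb : T.IsExtended H b)
    (h : T.compress H b = 0) : b = 0 := by
  refine eq_zero_of_unit_columns hb.mem fun x hx => ?_
  by_cases hxH : x ∈ H.carrier
  · rw [T.stdVec_eq_incl₂ H ⟨x, hxH⟩, show ∀ ξ, b (T.incl₂ H ξ) =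
      T.incl₂ H (T.compress H b ξ) from DFunLike.congr_fun hb.comp_incl₂, h]
    exact map_zero _
  · exact hb.apply_unit x hx hxH

theorem IsExtended.eq {a b : ℓ²(G) →L[ℂ] ℓ²(G)} (ha : T.IsExtended H a) (hb : T.IsExtended H b)
    (h : T.compress H a = T.compress H b) : a = b := by
  have h1 : T.IsExtended H (a + (-1 : ℂ) • b) := ha.add (hb.smul _)
  have h2 := h1.eq_zero (by rw [compress_add, compress_smul, h, neg_one_smul, add_neg_cancel])
  rwa [neg_one_smul, ← sub_eq_add_neg, sub_eq_zero] at h2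

variable (T H) in
/-- The embedding of `C*_r(Σ_H; H)` into `C*_r(Σ; G)`, inverse to compression to `ℓ²(H)`. -/
theorem exists_embedding : ∃ ι : (T.restrict H).reducedCStar →⋆ₙₐ[ℂ] T.reducedCStar,
    (∀ c, ‖ι c‖ = ‖c‖) ∧ (∀ c, T.IsExtended H (ι c).1) ∧ ∀ c, T.compress H (ι c).1 = c.1 := by
  have : LocallyCompactSpace H.carrier := H.isOpen.locallyCompactSpace
  let E : (ℓ²(G) →L[ℂ] ℓ²(G)) →ₗ[ℂ] (ℓ²(H.carrier) →L[ℂ] ℓ²(H.carrier)) :=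
    { toFun := T.compress H
      map_add' := T.compress_add H
      map_smul' := T.compress_smul H }
  refine exists_starHom_right_inverse T.reducedCStar (T.imageCStar H) (T.restrict H).reducedCStar
    (fun _ hb => IsExtended.mem hb) isClosed_imageCStar isClosed_reducedCStar E
    (fun _ hb => IsExtended.compress_mem hb)
    (fun _ _ _ hb => compress_mul_of_comp_incl₂ (IsExtended.comp_incl₂ hb))
    (fun b _ => T.compress_star H b) (fun _ hb => IsExtended.eq_zero hb) fun c hc => ?_
  refine closure_mono ?_ (Cc.mem_reducedCStar_iff.1 hc)
  rintro _ ⟨f, rfl⟩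
  exact ⟨_, isExtended_regularRep_extend f, Cc.compress_regularRep_extend f⟩

/-- If `H` is closed, compression to `ℓ²(H)` implements the restriction of sections to `H`. -/
theorem compress_mem_of_isClosed (hH : IsClosed H.carrier) {a : ℓ²(G) →L[ℂ] ℓ²(G)}
    (ha : a ∈ T.reducedCStar) : T.compress H a ∈ (T.restrict H).reducedCStar := by
  classical
  refine closure_minimal ?_ (isClosed_reducedCStar.preimage (T.continuous_compress H))
    (Cc.mem_reducedCStar_iff.1 ha)
  rintro _ ⟨f, rfl⟩
  let ψ : G → ℂ := H.carrier.indicator 1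
  have hψ : Continuous ψ := by
    have h0 : frontier H.carrier = ∅ := IsClopen.frontier_eq ⟨hH, H.isOpen⟩
    exact continuous_one.indicator (by simp [h0])
  have hsupp : tsupport ψ ⊆ H.carrier :=
    closure_minimal Set.support_indicator_subset hH
  obtain ⟨g, hg⟩ := (f.mulFun ψ hψ).exists_extend_eq (H := H) fun σ hσ =>
    hsupp (Cc.proj_mem_of_mem_tsupport_mulFun hσ)
  have h : T.compress H f.regularRep = T.compress H g.extend.regularRep := by
    refine T.compress_congr H fun β hβ γ hγ => ?_
    rw [hg, Cc.regularRep_entry, Cc.regularRep_entry]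
    by_cases hs : src γ = src β
    · rw [Cc.kernel_of_eq _ hs, Cc.kernel_of_eq _ hs]
      change _ = ψ _ * _
      have h1 : mul γ (inv β) ∈ H.carrier :=
        H.mul_mem _ hγ _ (H.inv_mem _ hβ) (by rw [hs, rng_inv])
      rw [proj_lift_mul_inv hs, show ψ (mul γ (inv β)) = 1 from Set.indicator_of_mem h1 _, one_mul]
    · rw [Cc.kernel_of_ne _ hs, Cc.kernel_of_ne _ hs]
  change T.compress H f.regularRep ∈ (T.restrict H).reducedCStar
  rw [h, Cc.compress_regularRep_extend]
  exact Cc.regularRep_mem g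

theorem exists_isConditionalExpectation
    {ι : (T.restrict H).reducedCStar →⋆ₙₐ[ℂ] T.reducedCStar}
    (hι : ∀ c, ‖ι c‖ = ‖c‖) (hext : ∀ c, T.IsExtended H (ι c).1)
    (hinv : ∀ c, T.compress H (ι c).1 = c.1) (hH : IsClosed H.carrier) :
    ∃ F : T.reducedCStar →ₗ[ℂ] T.reducedCStar,
      IsConditionalExpectation (NonUnitalStarAlgHom.range ι) F := by
  let E : T.reducedCStar →ₗ[ℂ] (T.restrict H).reducedCStar :=
    { toFun := fun a => ⟨T.compress H a.1, compress_mem_of_isClosed hH a.2⟩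
      map_add' := fun a b => Subtype.ext (T.compress_add H a.1 b.1)
      map_smul' := fun c a => Subtype.ext (T.compress_smul H c a.1) }
  refine ⟨_, isConditionalExpectation_comp ι hι E (fun c => Subtype.ext (hinv c))
    (fun a => T.norm_compress_le H a.1) (fun a => ?_) (fun c a => Subtype.ext ?_)
    (fun c a => Subtype.ext ?_)⟩
  · have h : T.compress H (star a * a).1 =
        (a.1 ∘L T.incl₂ H).adjoint ∘L (a.1 ∘L T.incl₂ H) := by
      rw [ContinuousLinearMap.adjoint_comp]
      rfl
    obtain ⟨c, hc, h1⟩ := exists_star_mul_self_of_mem (T.restrict H).reducedCStar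
      isClosed_reducedCStar (a.1 ∘L T.incl₂ H) (h ▸ compress_mem_of_isClosed hH (star a * a).2)
    exact ⟨⟨c, hc⟩, Subtype.ext (h.trans h1)⟩
  · have h := compress_mul_of_star_comp_incl₂ (a := a.1) (hext c).star_comp_incl₂
    exact h.trans (congrArg (· * T.compress H a.1) (hinv c))
  · have h := compress_mul_of_comp_incl₂ (a := a.1) (hext c).comp_incl₂
    exact h.trans (congrArg (T.compress H a.1 * ·) (hinv c))

end Twist

/-! ### Closedness from a conditional expectation -/

/-- An arrow of an étale groupoid has an open neighbourhood on which both the range map and the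
source map are injective. -/
theorem IsEtale.exists_injOn_rng_src {G : Type*} [TopologicalSpace G] [TopGroupoid G] [IsEtale G]
    (γ : G) : ∃ U : Set G, IsOpen U ∧ γ ∈ U ∧ Set.InjOn rng U ∧ Set.InjOn src U := by
  obtain ⟨U, hU, hγU, hUr⟩ := IsEtale.exists_injOn_rng γ
  obtain ⟨V, hV, hγV, hVr⟩ := IsEtale.exists_injOn_rng (inv γ)
  refine ⟨U ∩ inv ⁻¹' V, hU.inter (hV.preimage continuous_arrowInv), ⟨hγU, hγV⟩,
    hUr.mono Set.inter_subset_left, fun b hb c hc hbc => ?_⟩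
  exact inv_inj_of_eq (hVr hb.2 hc.2 (by rw [rng_inv, rng_inv, hbc]))

namespace Twist

variable {S G : Type*} [TopologicalSpace S] [TopGroupoid S] [TopologicalSpace G] [TopGroupoid G]
  {T : Twist S G} {H : OpenSubgroupoid G}

theorem Cc.inv_mem_of_mem_tsupport_conjInv {f : T.Cc} {σ : S}
    (h : σ ∈ tsupport f.conjInv.toFun) : inv σ ∈ tsupport f.toFun := by
  have hsub : Function.support f.conjInv.toFun ⊆ inv ⁻¹' tsupport f.toFun := by
    refine fun τ hτ => subset_tsupport _ fun h0 => hτ ?_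
    change (starRingEnd ℂ) (f.toFun (inv τ)) = 0
    rw [h0, map_zero]
  exact closure_minimal hsub (isClosed_closure.preimage continuous_arrowInv) h

variable [IsEtale G]

/-- Convolution by a section supported over a set on which the source map is injective sends basis
vectors at units to multiples of basis vectors. -/
theorem Cc.regularRep_stdVec_src {g : T.Cc} {U : Set G} (hU : Set.InjOn src U)
    (hg : ∀ σ ∈ tsupport g.toFun, T.proj σ ∈ U) {γ : G} (hγ : γ ∈ U) :
    g.regularRep (stdVec (src γ)) = g.kernel γ (src γ) • stdVec γ := by
  ext η
  rw [regularRep_entry]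
  change _ = _ * stdVec γ η
  by_cases h : η = γ
  · rw [h, stdVec_self, mul_one]
  · rw [stdVec_ne h, mul_zero]
    by_contra hne
    obtain ⟨hs, τ, hτ, hp⟩ := kernel_ne_zero hne
    rw [src_src] at hs
    rw [← hs, mul_inv_src] at hp
    exact h (hU (hp ▸ hg τ hτ) hγ hs)

theorem Cc.kernel_src_ne_zero {g : T.Cc} {σ : S} (h : g.toFun σ ≠ 0) :
    g.kernel (T.proj σ) (src (T.proj σ)) ≠ 0 := by
  intro h0
  rw [← symbol_regularRep, symbol, Cc.regularRep_entry, h0, mul_zero] at h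
  exact h rfl

/-- For `g` supported on a bisection, the product `g* d` determines the symbol of `d` wherever `g`
does not vanish. -/
theorem symbol_eq_of_star_mul_eq (f g : T.Cc) {d : ℓ²(G) →L[ℂ] ℓ²(G)} {U : Set G}
    (hs : Set.InjOn src U) (hg : ∀ σ ∈ tsupport g.toFun, T.proj σ ∈ U) {σ : S}
    (hσU : T.proj σ ∈ U) (hgσ : g.toFun σ ≠ 0)
    (h : star g.regularRep * d = star g.regularRep * f.regularRep) :
    T.symbol d σ = f.toFun σ := by
  rw [← symbol_regularRep f, symbol, symbol]
  congr 1
  have key : ∀ a : ℓ²(G) →L[ℂ] ℓ²(G),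
      (star g.regularRep * a) (stdVec (src (T.proj σ))) (src (T.proj σ)) =
        (starRingEnd ℂ) (g.kernel (T.proj σ) (src (T.proj σ))) *
          a (stdVec (src (T.proj σ))) (T.proj σ) := by
    intro a
    change (star g.regularRep) (a (stdVec (src (T.proj σ)))) (src (T.proj σ)) = _
    rw [← inner_stdVec_left, ContinuousLinearMap.star_eq_adjoint,
      ContinuousLinearMap.adjoint_inner_right, Cc.regularRep_stdVec_src hs hg hσU,
      inner_smul_left, inner_stdVec_left]
  have h5 := key d
  rw [h, key] at h5
  exact mul_left_cancel₀ ((map_ne_zero _).2 (Cc.kernel_src_ne_zero hgσ)) h5.symm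

variable [T2Space S] [T2Space G]

/-- If `g` is supported in `H ∩ U` and `f` in `U` for an open bisection `U`, then `g* * f` is
supported on units of `H`. -/
theorem Cc.exists_extend_eq_conjInv_conv (f g : T.Cc) {U : Set G} (hU : IsOpen U)
    (hr : Set.InjOn rng U) (hs : Set.InjOn src U) (hf : ∀ σ ∈ tsupport f.toFun, T.proj σ ∈ U)
    (hg : ∀ σ ∈ tsupport g.toFun, T.proj σ ∈ U ∩ H.carrier) :
    ∃ k : (T.restrict H).Cc, k.extend.regularRep = star g.regularRep * f.regularRep := by
  obtain ⟨k, hk, hksupp⟩ := exists_conv_of_injOn g.conjInv f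
    (hU.preimage continuous_arrowInv)
    (fun a ha b hb h => inv_inj_of_eq (hs ha hb (by rw [src_inv, src_inv, h])))
    (fun σ hσ => by
      have h1 := (hg _ (inv_mem_of_mem_tsupport_conjInv hσ)).1
      rwa [T.proj_inv] at h1)
  have hclosed : IsClosed (mulSet (tsupport g.conjInv.toFun) (tsupport f.toFun)) :=
    (isCompact_mulSet g.conjInv.hasCompactSupport.isCompact
      f.hasCompactSupport.isCompact).isClosed
  obtain ⟨k', hk'⟩ := k.exists_extend_eq (H := H) fun σ hσ => by
    obtain ⟨⟨ρ, τ⟩, ⟨hc, hρ, hτ⟩, rfl⟩ := closure_minimal hksupp hclosed hσ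
    change src ρ = rng τ at hc
    have h1 := hg _ (inv_mem_of_mem_tsupport_conjInv hρ)
    have hc' : src (T.proj ρ) = rng (T.proj τ) := by rw [← T.proj_src, hc, T.proj_rng]
    have h2 : T.proj (inv ρ) = T.proj τ :=
      hr h1.1 (hf τ hτ) (by rw [T.proj_inv, rng_inv, hc'])
    rw [h2] at h1
    rw [T.proj_inv] at h2
    change T.proj (mul ρ τ) ∈ _
    rw [T.proj_mul _ _ hc, ← TopGroupoid.inv_inv (T.proj ρ), h2, inv_mul]
    exact H.src_mem h1.2
  exact ⟨k', by rw [hk', hk, regularRep_conjInv]⟩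

variable [LocallyCompactSpace G]

/-- A conditional expectation onto `C*_r(Σ_H; H)` does not change the values on `H` of a section
`f` supported over an open bisection `U`: for `g` supported in `H ∩ U`, the product `g* * f` lies
in `C*_r(Σ_H; H)`, so that `g* * F f = F (g* * f) = g* * f`. -/
theorem symbol_expectation_eq
    {ι : (T.restrict H).reducedCStar →⋆ₙₐ[ℂ] T.reducedCStar}
    (hι : ∀ f : (T.restrict H).Cc, ι f.toReduced = f.extend.toReduced)
    {F : T.reducedCStar →ₗ[ℂ] T.reducedCStar}
    (hF : IsConditionalExpectation (NonUnitalStarAlgHom.range ι) F) (f : T.Cc) {U : Set G}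
    (hU : IsOpen U) (hr : Set.InjOn rng U) (hs : Set.InjOn src U)
    (hf : ∀ σ ∈ tsupport f.toFun, T.proj σ ∈ U) {σ : S} (hσU : T.proj σ ∈ U)
    (hσH : T.proj σ ∈ H.carrier) : T.symbol (F f.toReduced).1 σ = f.toFun σ := by
  obtain ⟨g, hg, hgσ⟩ := Cc.exists_ne_zero T (hU.inter H.isOpen) ⟨hσU, hσH⟩
  have hgσ := hgσ σ rfl
  obtain ⟨k, hk⟩ := Cc.exists_extend_eq_conjInv_conv f g hU hr hs hf hg
  obtain ⟨g', hg'⟩ := g.exists_extend_eq (H := H) fun σ hσ => (hg σ hσ).2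
  have h1 : ι g'.toReduced = g.toReduced := by rw [hι, hg']
  have h2 : ι k.toReduced = star g.toReduced * f.toReduced := by
    rw [hι]
    exact Subtype.ext hk
  have h4 : star g.regularRep * (F f.toReduced).1 = star g.regularRep * f.regularRep :=
    congrArg Subtype.val (hF.star_mul_apply h1 h2)
  exact symbol_eq_of_star_mul_eq f g hs (fun σ hσ => (hg σ hσ).1) hσU hgσ h4

theorem isClosed_of_isConditionalExpectation
    {ι : (T.restrict H).reducedCStar →⋆ₙₐ[ℂ] T.reducedCStar}
    (hι : ∀ f : (T.restrict H).Cc, ι f.toReduced = f.extend.toReduced)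
    (hext : ∀ c, T.IsExtended H (ι c).1) {F : T.reducedCStar →ₗ[ℂ] T.reducedCStar}
    (hF : IsConditionalExpectation (NonUnitalStarAlgHom.range ι) F) : IsClosed H.carrier := by
  refine isClosed_of_closure_subset fun γ hγ => ?_
  by_contra hγH
  obtain ⟨U, hU, hγU, hr, hs⟩ := IsEtale.exists_injOn_rng_src γ
  obtain ⟨f, hf, hfγ⟩ := Cc.exists_ne_zero T hU hγU
  obtain ⟨V, hV, hγV, u, hu, hpu⟩ := T.exists_continuousOn_section γ
  have hd : T.IsExtended H (F f.toReduced).1 := by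
    obtain ⟨c, hc⟩ := hF.mem f.toReduced
    have hc' : (ι c).1 = (F f.toReduced).1 := congrArg Subtype.val hc
    exact hc' ▸ hext c
  have hval := fun σ => symbol_expectation_eq (σ := σ) hι hF f hU hr hs hf
  have hcont := continuous_symbol (F f.toReduced).2
  generalize (F f.toReduced).1 = d at hd hval hcont
  have h1 : ContinuousAt (fun x => T.symbol d (u x) - f.toFun (u x)) γ :=
    ((hcont.sub f.continuous_toFun).comp_continuousOn hu).continuousAt (hV.mem_nhds hγV)
  have h2 : T.symbol d (u γ) - f.toFun (u γ) ≠ 0 := by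
    rw [symbol_eq_zero_of_notMem hd (by rwa [hpu γ hγV]), zero_sub]
    exact neg_ne_zero.2 (hfγ _ (hpu γ hγV))
  obtain ⟨x, hxH, ⟨hx, hxU⟩, hxV⟩ := ((mem_closure_iff_frequently.1 hγ).and_eventually
    (((h1.eventually_ne h2).and (hU.mem_nhds hγU)).and (hV.mem_nhds hγV))).exists
  rw [hval (u x) (by rwa [hpu x hxV]) (by rwa [hpu x hxV]), sub_self] at hx
  exact hx rfl

theorem embedding_toReduced {ι : (T.restrict H).reducedCStar →⋆ₙₐ[ℂ] T.reducedCStar}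
    (hext : ∀ c, T.IsExtended H (ι c).1) (hinv : ∀ c, T.compress H (ι c).1 = c.1)
    (f : (T.restrict H).Cc) : ι f.toReduced = f.extend.toReduced :=
  Subtype.ext ((hext f.toReduced).eq (isExtended_regularRep_extend f)
    ((hinv f.toReduced).trans (Cc.compress_regularRep_extend f).symm))

end Twist

theorem lemma3p3 {S G : Type*} [TopologicalSpace S] [TopGroupoid S]
    [TopologicalSpace G] [TopGroupoid G] [T2Space S] [LocallyCompactSpace S]
    [T2Space G] [LocallyCompactSpace G] [IsEtale G] (T : Twist S G) (H : OpenSubgroupoid G) :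
    ∃ ι : (T.restrict H).reducedCStar →⋆ₙₐ[ℂ] T.reducedCStar,
      (∀ f : (T.restrict H).Cc, ι f.toReduced = f.extend.toReduced) ∧
      Isometry ι ∧
      ((∃ F : T.reducedCStar →ₗ[ℂ] T.reducedCStar,
          IsConditionalExpectation (NonUnitalStarAlgHom.range ι) F) ↔
        IsClosed H.carrier) := by
  obtain ⟨ι, hnorm, hext, hinv⟩ := T.exists_embedding H
  have hι := Twist.embedding_toReduced hext hinv
  refine ⟨ι, hι, AddMonoidHomClass.isometry_of_norm ι hnorm, ?_, ?_⟩
  · rintro ⟨F, hF⟩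
    exact Twist.isClosed_of_isConditionalExpectation hι hext hF
  · exact Twist.exists_isConditionalExpectation hnorm hext hinv
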